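/- **Setting.** Let $N\ge 0$ and let $R_{12}(k_1,k_2)\in \mathrm{End}(\mathbb C^N\otimes\mathbb C^N)$ ($k_1,k_2\in\mathbb R$, arbitrary dependence on $k_1,k_2$) satisfy, for all real $k_1,k_2,k_3$, $$R_{12}(k_1,k_2)R_{13}(k_1,k_3)R_{23}(k_2,k_3)=R_{23}(k_2,k_3)R_{13}(k_1,k_3)R_{12}(k_1,k_2),\qquad R_{12}(k_1,k_2)R_{21}(k_2,k_1)=\mathbb I\otimes\mathbb I .$$ Write $a_1(k)=\sum_i a_i(k)\,e_i\otimes\mathbb I$, $a_2(k)=\sum_i a_i(k)\,\mathbb I\otimes e_i$, $a^\dagger_1(k)=\sum_i a_i^\dagger(k)\,e_i^\dagger\otimes\mathbb I$, $a^\dagger_2(k)=\sum_i a_i^\dagger(k)\,\mathbb I\otimes e_i^\dagger$, $\delta_{12}=\sum_i e_i\otimes e_i^\dagger$, where $e_i$ is the standard basis of column vectors and $e_i^\dagger$ the dual basis of row vectors; $X_1=X\otimes\mathbb I$, $X_2=\mathbb I\otimes X$ for an $N\times N$ matrix $X$ (possibly with operator entries); and $b_{12}(k)=\sum_{i,j}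 b_{ij}(k)\,e_i\otimes e_j^\dagger$. *The ZF algebra $\mathcal A_R$* has generators $a_i(k),a_i^\dagger(k)$ ($1\le i\le N$, $k\in\mathbb R$) and relations $$a_1(k_1)a_2(k_2)=R_{21}(k_2,k_1)a_2(k_2)a_1(k_1),\qquad a^\dagger_1(k_1)a^\dagger_2(k_2)=a^\dagger_2(k_2)a^\dagger_1(k_1)R_{21}(k_2,k_1),$$ $$a_1(k_1)a^\dagger_2(k_2)=a^\dagger_2(k_2)R_{12}(k_1,k_2)a_1(k_1)+\delta(k_1-k_2)\,\delta_{12}.$$ It is taken in its Fock representation. The Fock space $\mathcal F_R$ consists of all sequences $(\varphi_n)_{n\ge0}$ of functions $\varphi_n:\mathbb R^n\to(\mathbb C^N)^{\otimes n}$ with $\varphi_n(\dots,k,k',\dots)=R(k,k')\,\varphi_n(\dots,k',k,\dots)$ at any two neighbouring places ($R(k,k')$ acts on these two places, and the tensor factors are exchanged together with the arguments). The operator $a_i(k)$ is evaluation of the first argument and index at $(k,i)$. The operator-valued distribution $a^\dagger_i(k)$ is given by the linear maps $\Phi\mapsto\int dk\,a^\dagger_i(k)\Phi(k)$ on arbitrary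 functions $\Phi:\mathbb R\to\mathcal F_R$; these have no vacuum component and are determined by the third relation. Relations that contain $a^\dagger(k_2)$ are understood after application to an arbitrary $\Phi(k_2)$ and integration over $k_2$, so that $\delta(k_1\mp k_2)$ gives $\Phi(\pm k_1)$. *Well-bred vertex operator.* An $N\times N$ matrix $T(k)$ of operators on $\mathcal F_R$ is a *vertex operator* if for some numerical matrix-valued functions $T^{(n)}_{01\dots n}(k_0,\dots,k_n)$ $$T(k_0)=\mathbb I+\sum_{n\ge1}\frac{(-1)^n}{(n-1)!}\int dk_1\cdots dk_n\;a^\dagger_{n\dots1}\,T^{(n)}_{01\dots n}\,a_{1\dots n},$$ where $a_{1\dots n}=a_1(k_1)\cdots a_n(k_n)$ and $a^\dagger_{n\dots1}=a^\dagger_n(k_n)\cdots a^\dagger_1(k_1)$ act in the auxiliary spaces $1,\dots,n$ (the series converging on every component of every Fock vector). It is *well-bred* if $$T_1(k_1)a_2(k_2)=R_{21}(k_2,k_1)a_2(k_2)T_1(k_1),\qquad T_1(k_1)a^\dagger_2(k_2)=a^\dagger_2(k_2)R_{12}(k_1,k_2)T_1(k_1).$$ **Theorem.** The operators $a_i(k),a_i^\dagger(k)$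 on $\mathcal F_R$ satisfy the relations of $\mathcal A_R$; there is exactly one well-bred vertex operator $T$, and $T(k)$ is invertible for every $k$. Let $B(k)$, $k\in\mathbb R$, be a numerical $N\times N$ matrix with $$R_{12}(k_1,k_2)B_1(k_1)R_{21}(k_2,-k_1)B_2(k_2)=B_2(k_2)R_{12}(k_1,-k_2)B_1(k_1)R_{21}(-k_2,-k_1),\qquad B(k)B(-k)=\mathbb I_N,$$ for all real $k,k_1,k_2$. Put $$b(k)=T(k)B(k)T(-k)^{-1},\qquad \tilde a(k)=\tfrac12\big(a(k)+b(k)a(-k)\big),\qquad \tilde a^\dagger(k)=\tfrac12\big(a^\dagger(k)+a^\dagger(-k)b(-k)\big).$$ Then $\tilde a,\tilde a^\dagger,b$ satisfy the relations of the boundary algebra: $$\tilde a_1(k_1)\tilde a_2(k_2)=R_{21}(k_2,k_1)\tilde a_2(k_2)\tilde a_1(k_1),\qquad \tilde a^\dagger_1(k_1)\tilde a^\dagger_2(k_2)=\tilde a^\dagger_2(k_2)\tilde a^\dagger_1(k_1)R_{21}(k_2,k_1),$$ $$\tilde a_1(k_1)\tilde a^\dagger_2(k_2)=\tilde a^\dagger_2(k_2)R_{12}(k_1,k_2)\tilde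 a_1(k_1)+\tfrac12\delta_{12}\,\delta(k_1-k_2)+\tfrac12 b_{12}(k_1)\,\delta(k_1+k_2),$$ $$\tilde a_1(k_1)b_2(k_2)=R_{21}(k_2,k_1)b_2(k_2)R_{12}(k_1,-k_2)\tilde a_1(k_1),\qquad b_1(k_1)\tilde a^\dagger_2(k_2)=\tilde a^\dagger_2(k_2)R_{12}(k_1,k_2)b_1(k_1)R_{21}(k_2,-k_1),$$ $$R_{12}(k_1,k_2)b_1(k_1)R_{21}(k_2,-k_1)b_2(k_2)=b_2(k_2)R_{12}(k_1,-k_2)b_1(k_1)R_{21}(-k_2,-k_1),\qquad b(k)b(-k)=\mathbb I,$$ and moreover $\tilde a(k)=b(k)\tilde a(-k)$ and $\tilde a^\dagger(k)=\tilde a^\dagger(-k)b(-k)$. -/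

import Mathlib

open scoped Kronecker

noncomputable section

/-! ## Auxiliary spaces -/

/-- Exchange of the two tensor factors of a matrix on `ℂ^N ⊗ ℂ^N`: from `M₁₂` to `M₂₁`. -/
def flipLegs {N : ℕ} {A : Type*} (M : Matrix (Fin N × Fin N) (Fin N × Fin N) A) :
    Matrix (Fin N × Fin N) (Fin N × Fin N) A :=
  M.submatrix Prod.swap Prod.swap

/-- `X₁ = X ⊗ 𝕀` -/
def leg1 {N : ℕ} {A : Type*} [Semiring A] (X : Matrix (Fin N) (Fin N) A) :
    Matrix (Fin N × Fin N) (Fin N × Fin N) A :=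
  X ⊗ₖ (1 : Matrix (Fin N) (Fin N) A)

/-- `X₂ = 𝕀 ⊗ X` -/
def leg2 {N : ℕ} {A : Type*} [Semiring A] (X : Matrix (Fin N) (Fin N) A) :
    Matrix (Fin N × Fin N) (Fin N × Fin N) A :=
  (1 : Matrix (Fin N) (Fin N) A) ⊗ₖ X

/-- `M₁₂` on three auxiliary spaces. -/
def emb12 {N : ℕ} (M : Matrix (Fin N × Fin N) (Fin N × Fin N) ℂ) :
    Matrix (Fin N × Fin N × Fin N) (Fin N × Fin N × Fin N) ℂ :=
  Matrix.of fun x y => if x.2.2 = y.2.2 then M (x.1, x.2.1) (y.1, y.2.1) else 0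

/-- `M₁₃` on three auxiliary spaces. -/
def emb13 {N : ℕ} (M : Matrix (Fin N × Fin N) (Fin N × Fin N) ℂ) :
    Matrix (Fin N × Fin N × Fin N) (Fin N × Fin N × Fin N) ℂ :=
  Matrix.of fun x y => if x.2.1 = y.2.1 then M (x.1, x.2.2) (y.1, y.2.2) else 0

/-- `M₂₃` on three auxiliary spaces. -/
def emb23 {N : ℕ} (M : Matrix (Fin N × Fin N) (Fin N × Fin N) ℂ) :
    Matrix (Fin N × Fin N × Fin N) (Fin N × Fin N × Fin N) ℂ :=
  Matrix.of fun x y => if x.1 = y.1 then M (x.2.1, x.2.2) (y.2.1, y.2.2) else 0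

/-- An evaluated `R`-matrix of size `N² × N²` with real spectral parameters, obeying the
Yang-Baxter equation and the unitarity condition. Nothing is assumed on its dependence on the
spectral parameters. -/
structure RMatrix (N : ℕ) where
  /-- `R₁₂(k₁, k₂)` -/
  R12 : ℝ → ℝ → Matrix (Fin N × Fin N) (Fin N × Fin N) ℂ
  yangBaxter : ∀ k₁ k₂ k₃ : ℝ,
    emb12 (R12 k₁ k₂) * emb13 (R12 k₁ k₃) * emb23 (R12 k₂ k₃) =
      emb23 (R12 k₂ k₃) * emb13 (R12 k₁ k₃) * emb12 (R12 k₁ k₂)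
  unitarity : ∀ k₁ k₂ : ℝ, R12 k₁ k₂ * flipLegs (R12 k₂ k₁) = 1

namespace RMatrix

variable {N : ℕ} (R : RMatrix N)

/-- `R₂₁(p, q)` -/
def R21 (p q : ℝ) : Matrix (Fin N × Fin N) (Fin N × Fin N) ℂ := flipLegs (R.R12 p q)

/-! ## Operator-valued distributions

On a complex vector space `V` an annihilation-type generator is given by its pointwise values
`a i k : V → V`. A creation-type generator `a†_i(k)` is an operator-valued distribution in `k`; it is
given by the linear map `Φ ↦ ∫ dk a†_i(k) Φ(k)` on `V`-valued functions `Φ` of `k`. An identity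
containing `a†(k₂)` is tested against an arbitrary `Φ(k₂)`; thus `δ(k₁ - k₂)` becomes `Φ(k₁)` and
`δ(k₁ + k₂)` becomes `Φ(-k₁)`. -/

/-- A numerical matrix regarded as a matrix of (scalar) operators. -/
def scalarOp (V : Type*) [AddCommGroup V] [Module ℂ V] {ι : Type*} (M : Matrix ι ι ℂ) :
    Matrix ι ι (Module.End ℂ V) :=
  M.map (algebraMap ℂ (Module.End ℂ V))

/-- The exchange relations of the Zamolodchikov-Faddeev algebra. -/
structure ZFRelations {V : Type*} [AddCommGroup V] [Module ℂ V]
    (a : Fin N → ℝ → Module.End ℂ V) (adag : Fin N → (ℝ → V) →ₗ[ℂ] V) : Prop where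
  /-- `a₁(k₁) a₂(k₂) = R₂₁(k₂,k₁) a₂(k₂) a₁(k₁)` -/
  a_a : ∀ (k₁ k₂ : ℝ) (i j : Fin N),
    a i k₁ * a j k₂ = ∑ i', ∑ j', R.R21 k₂ k₁ (i, j) (i', j') • (a j' k₂ * a i' k₁)
  /-- `a†₁(k₁) a†₂(k₂) = a†₂(k₂) a†₁(k₁) R₂₁(k₂,k₁)` -/
  adag_adag : ∀ (i j : Fin N) (Φ : ℝ → ℝ → V),
    adag i (fun k₁ => adag j (fun k₂ => Φ k₁ k₂)) =
      ∑ i', ∑ j', adag j' (fun k₂ => adag i' (fun k₁ =>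
        R.R21 k₂ k₁ (i', j') (i, j) • Φ k₁ k₂))
  /-- `a₁(k₁) a†₂(k₂) = a†₂(k₂) R₁₂(k₁,k₂) a₁(k₁) + δ(k₁ - k₂) δ₁₂` -/
  a_adag : ∀ (k₁ : ℝ) (i j : Fin N) (Φ : ℝ → V),
    a i k₁ (adag j Φ) =
      (∑ i', ∑ j', adag j' (fun k₂ => R.R12 k₁ k₂ (i, j') (i', j) • a i' k₁ (Φ k₂)))
        + (if i = j then Φ k₁ else 0)

/-- The exchange relations of the boundary algebra. -/
structure BoundaryRelations {V : Type*} [AddCommGroup V] [Module ℂ V]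
    (a : Fin N → ℝ → Module.End ℂ V) (adag : Fin N → (ℝ → V) →ₗ[ℂ] V)
    (b : ℝ → Matrix (Fin N) (Fin N) (Module.End ℂ V)) : Prop where
  /-- `a₁(k₁) a₂(k₂) = R₂₁(k₂,k₁) a₂(k₂) a₁(k₁)` -/
  a_a : ∀ (k₁ k₂ : ℝ) (i j : Fin N),
    a i k₁ * a j k₂ = ∑ i', ∑ j', R.R21 k₂ k₁ (i, j) (i', j') • (a j' k₂ * a i' k₁)
  /-- `a†₁(k₁) a†₂(k₂) = a†₂(k₂) a†₁(k₁) R₂₁(k₂,k₁)` -/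
  adag_adag : ∀ (i j : Fin N) (Φ : ℝ → ℝ → V),
    adag i (fun k₁ => adag j (fun k₂ => Φ k₁ k₂)) =
      ∑ i', ∑ j', adag j' (fun k₂ => adag i' (fun k₁ =>
        R.R21 k₂ k₁ (i', j') (i, j) • Φ k₁ k₂))
  /-- `a₁(k₁) a†₂(k₂) = a†₂(k₂) R₁₂(k₁,k₂) a₁(k₁) + ½ δ₁₂ δ(k₁ - k₂) + ½ b₁₂(k₁) δ(k₁ + k₂)` -/
  a_adag : ∀ (k₁ : ℝ) (i j : Fin N) (Φ : ℝ → V),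
    a i k₁ (adag j Φ) =
      (∑ i', ∑ j', adag j' (fun k₂ => R.R12 k₁ k₂ (i, j') (i', j) • a i' k₁ (Φ k₂)))
        + (1 / 2 : ℂ) • (if i = j then Φ k₁ else 0)
        + (1 / 2 : ℂ) • b k₁ i j (Φ (-k₁))
  /-- `a₁(k₁) b₂(k₂) = R₂₁(k₂,k₁) b₂(k₂) R₁₂(k₁,-k₂) a₁(k₁)` -/
  a_b : ∀ (k₁ k₂ : ℝ) (i j j' : Fin N),
    a i k₁ * b k₂ j j' =
      ∑ i', (scalarOp V (R.R21 k₂ k₁) * leg2 (b k₂) * scalarOp V (R.R12 k₁ (-k₂)))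
        (i, j) (i', j') * a i' k₁
  /-- `b₁(k₁) a†₂(k₂) = a†₂(k₂) R₁₂(k₁,k₂) b₁(k₁) R₂₁(k₂,-k₁)` -/
  b_adag : ∀ (k₁ : ℝ) (i i' j : Fin N) (Φ : ℝ → V),
    b k₁ i i' (adag j Φ) =
      ∑ j', adag j' (fun k₂ =>
        (scalarOp V (R.R12 k₁ k₂) * leg1 (b k₁) * scalarOp V (R.R21 k₂ (-k₁)))
          (i, j') (i', j) (Φ k₂))
  /-- the reflection equation for `b` -/
  b_b : ∀ k₁ k₂ : ℝ,
    scalarOp V (R.R12 k₁ k₂) * leg1 (b k₁) * scalarOp V (R.R21 k₂ (-k₁)) * leg2 (b k₂) =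
      leg2 (b k₂) * scalarOp V (R.R12 k₁ (-k₂)) * leg1 (b k₁) * scalarOp V (R.R21 (-k₂) (-k₁))
  /-- `b(k) b(-k) = 𝕀` -/
  b_inv : ∀ k : ℝ, b k * b (-k) = 1

/-! ## The ZF algebra in its Fock representation -/

/-- Lists of one-particle labels `(k, i)`. A function on this type is a sequence
`(φₙ)ₙ` of `(ℂ^N)^{⊗ n}`-valued functions `φₙ(k₁, …, kₙ)`, with vacuum component `φ []`. -/
abbrev Word (N : ℕ) : Type := List (ℝ × Fin N)

/-- The Fock space: the sequences of wave functions with the exchange symmetry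
`φ(…, k, k', …) = R(k, k') φ(…, k', k, …)` at every pair of neighbouring places. -/
def Fock : Submodule ℂ (Word N → ℂ) where
  carrier := {φ | ∀ (l l' : Word N) (p q : ℝ) (i j : Fin N),
    φ (l ++ (p, i) :: (q, j) :: l') =
      ∑ i', ∑ j', R.R12 p q (i, j) (i', j') * φ (l ++ (q, j') :: (p, i') :: l')}
  add_mem' := by
    intro φ ψ hφ hψ l l' p q i j
    simp only [Pi.add_apply, hφ l l' p q i j, hψ l l' p q i j, mul_add, Finset.sum_add_distrib]
  zero_mem' := by
    intro l l' p q i j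
    simp
  smul_mem' := by
    intro c φ hφ l l' p q i j
    simp only [Pi.smul_apply, smul_eq_mul, hφ l l' p q i j, Finset.mul_sum]
    exact Finset.sum_congr rfl fun _ _ => Finset.sum_congr rfl fun _ _ => by ring

/-- The annihilation operators `(a_i(k) φ)(k₁, …, kₙ) = φ(k, k₁, …, kₙ)` (label `i` at `k`). -/
def annihilate (i : Fin N) (k : ℝ) : Module.End ℂ R.Fock where
  toFun φ := ⟨fun w => φ.1 ((k, i) :: w), fun l l' p q i' j' => by
    simpa using φ.2 ((k, i) :: l) l' p q i' j'⟩
  map_add' _ _ := rfl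
  map_smul' _ _ := rfl

/-- Components of `∫ dk a†_j(k) Φ(k)`: there is no vacuum component, and the others are found by
taking out one particle by means of
`a_i(k) a†_j(k') = ∑ a†_m(k') R(k,k')_{im,sj} a_s(k) + δ_{ij} δ(k - k')`. -/
def createAux : Word N → Fin N → (ℝ → Word N → ℂ) → ℂ
  | [], _, _ => 0
  | (k, i) :: w, j, Φ =>
      (if i = j then Φ k w else 0) +
        ∑ s, ∑ m, createAux w m (fun k' v => R.R12 k k' (i, m) (s, j) * Φ k' ((k, s) :: v))

theorem createAux_add (w : Word N) : ∀ (j : Fin N) (Φ Ψ : ℝ → Word N → ℂ),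
    R.createAux w j (fun k v => Φ k v + Ψ k v) = R.createAux w j Φ + R.createAux w j Ψ := by
  induction w with
  | nil => intro j Φ Ψ; simp [createAux]
  | cons x w ih =>
    intro j Φ Ψ
    obtain ⟨k, i⟩ := x
    simp only [createAux, mul_add, ih, Finset.sum_add_distrib]
    split_ifs <;> ring

theorem createAux_smul (w : Word N) : ∀ (j : Fin N) (c : ℂ) (Φ : ℝ → Word N → ℂ),
    R.createAux w j (fun k v => c * Φ k v) = c * R.createAux w j Φ := by
  induction w with
  | nil => intro j c Φ; simp [createAux]
  | cons x w ih =>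
    intro j c Φ
    obtain ⟨k, i⟩ := x
    simp only [createAux, mul_left_comm _ c, ih, Finset.mul_sum, mul_add, mul_ite, mul_zero]

theorem createAux_sum {ι : Type*} (s : Finset ι) (w : Word N) (j : Fin N)
    (Φ : ι → ℝ → Word N → ℂ) :
    R.createAux w j (fun k v => ∑ x ∈ s, Φ x k v) = ∑ x ∈ s, R.createAux w j (Φ x) := by
  classical
  induction s using Finset.induction_on with
  | empty => simpa using R.createAux_smul w j 0 (fun _ _ => 0)
  | insert x s hx ih => simp only [Finset.sum_insert hx, createAux_add, ih]

theorem yangBaxter_apply (p q k : ℝ) (i j m x y c : Fin N) :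
    (∑ i', ∑ j', R.R12 p q (i, j) (i', j') *
      ∑ n, R.R12 p k (i', m) (x, n) * R.R12 q k (j', n) (y, c)) =
    ∑ t, ∑ n, R.R12 q k (j, m) (t, n) *
      ∑ s, R.R12 p k (i, n) (s, c) * R.R12 p q (s, t) (x, y) := by
  have h := congrFun (congrFun (R.yangBaxter p q k) (i, j, m)) (x, y, c)
  rw [Matrix.mul_assoc, Matrix.mul_assoc] at h
  simpa [Matrix.mul_apply, emb12, emb13, emb23, Fintype.sum_prod_type,
    Finset.sum_ite_irrel] using h

theorem unitarity_apply (p q : ℝ) (i j x y : Fin N) :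
    (∑ i', ∑ j', R.R12 p q (i, j) (i', j') * R.R12 q p (j', i') (y, x)) =
      if i = x ∧ j = y then 1 else 0 := by
  have h := congrFun (congrFun (R.unitarity p q) (i, j)) (x, y)
  simpa [Matrix.mul_apply, flipLegs, Fintype.sum_prod_type, Matrix.one_apply] using h

theorem createAux_cons_cons (p q : ℝ) (i j c : Fin N) (w : Word N) (Φ : ℝ → Word N → ℂ) :
    R.createAux ((p, i) :: (q, j) :: w) c Φ =
      (if i = c then Φ p ((q, j) :: w) else 0) +
      (∑ s, R.R12 p q (i, j) (s, c) * Φ q ((p, s) :: w)) +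
      ∑ n, R.createAux w n (fun k v => ∑ t, ∑ m, R.R12 q k (j, n) (t, m) *
        ∑ s, R.R12 p k (i, m) (s, c) * Φ k ((p, s) :: (q, t) :: v)) := by
  simp only [createAux, createAux_sum, Finset.mul_sum, Finset.sum_add_distrib,
    Finset.sum_ite_eq, Finset.mem_univ, if_true, add_assoc]
  congr 2
  conv_rhs => rw [Finset.sum_comm]; enter [2, t]; rw [Finset.sum_comm]; enter [2, m]; rw [Finset.sum_comm]
  conv_lhs => rw [Finset.sum_comm]; enter [2, t]; rw [Finset.sum_comm]
  rw [Finset.sum_comm]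

theorem createAux_symm (l w : Word N) (p q : ℝ) (i j : Fin N) :
    ∀ (c : Fin N) (Φ : ℝ → Word N → ℂ), (∀ k, Φ k ∈ R.Fock) →
      R.createAux (l ++ (p, i) :: (q, j) :: w) c Φ =
        ∑ i', ∑ j', R.R12 p q (i, j) (i', j') *
          R.createAux (l ++ (q, j') :: (p, i') :: w) c Φ := by
  induction l with
  | nil =>
    intro c Φ hΦ
    simp only [List.nil_append, createAux_cons_cons, mul_add, Finset.sum_add_distrib]
    have h1 : (∑ i', ∑ j', R.R12 p q (i, j) (i', j') *
        (if j' = c then Φ q ((p, i') :: w) else 0)) =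
        ∑ s, R.R12 p q (i, j) (s, c) * Φ q ((p, s) :: w) := by
      simp
    have h2 : (∑ i', ∑ j', R.R12 p q (i, j) (i', j') *
        ∑ s, R.R12 q p (j', i') (s, c) * Φ p ((q, s) :: w)) =
        if i = c then Φ p ((q, j) :: w) else 0 := by
      have : ∀ s, (∑ i', ∑ j', R.R12 p q (i, j) (i', j') *
          (R.R12 q p (j', i') (s, c) * Φ p ((q, s) :: w))) =
          if i = c ∧ j = s then Φ p ((q, s) :: w) else 0 := by
        intro s
        have := R.unitarity_apply p q i j c s
        simp only [← mul_assoc, ← Finset.sum_mul, this, ite_mul, one_mul, zero_mul]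
      simp only [Finset.mul_sum]
      rw [Finset.sum_congr rfl fun _ _ => Finset.sum_comm, Finset.sum_comm]
      simp only [this]
      by_cases h : i = c <;> simp [h]
    have h3 : ∀ n, (∑ i', ∑ j', R.R12 p q (i, j) (i', j') *
        R.createAux w n (fun k v => ∑ t, ∑ m, R.R12 p k (i', n) (t, m) *
          ∑ s, R.R12 q k (j', m) (s, c) * Φ k ((q, s) :: (p, t) :: v))) =
        R.createAux w n (fun k v => ∑ t, ∑ m, R.R12 q k (j, n) (t, m) *
          ∑ s, R.R12 p k (i, m) (s, c) * Φ k ((p, s) :: (q, t) :: v)) := by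
      intro n
      simp only [← createAux_smul, ← createAux_sum]
      congr 1
      funext k v
      have hs : ∀ s t, Φ k ((p, s) :: (q, t) :: v) =
          ∑ x, ∑ y, R.R12 p q (s, t) (x, y) * Φ k ((q, y) :: (p, x) :: v) :=
        fun s t => hΦ k [] v p q s t
      calc _ = ∑ x, ∑ y, (∑ i', ∑ j', R.R12 p q (i, j) (i', j') *
              ∑ m, R.R12 p k (i', n) (x, m) * R.R12 q k (j', m) (y, c)) *
              Φ k ((q, y) :: (p, x) :: v) := by
            simp only [Finset.mul_sum, Finset.sum_mul]
            rw [Finset.sum_congr rfl fun _ _ => Finset.sum_comm, Finset.sum_comm]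
            refine Finset.sum_congr rfl fun x _ => ?_
            rw [Finset.sum_congr rfl fun _ _ => Finset.sum_congr rfl fun _ _ =>
              Finset.sum_comm, Finset.sum_congr rfl fun _ _ => Finset.sum_comm, Finset.sum_comm]
            simp only [mul_assoc]
        _ = ∑ x, ∑ y, (∑ t, ∑ m, R.R12 q k (j, n) (t, m) *
              ∑ s, R.R12 p k (i, m) (s, c) * R.R12 p q (s, t) (x, y)) *
              Φ k ((q, y) :: (p, x) :: v) := by
            simp only [yangBaxter_apply]
        _ = _ := by
            simp only [hs, Finset.mul_sum, Finset.sum_mul]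
            rw [Finset.sum_congr rfl fun _ _ => Finset.sum_comm, Finset.sum_comm]
            refine Finset.sum_congr rfl fun t _ => ?_
            rw [Finset.sum_congr rfl fun _ _ => Finset.sum_comm, Finset.sum_comm]
            refine Finset.sum_congr rfl fun m _ => ?_
            rw [Finset.sum_congr rfl fun _ _ => Finset.sum_comm, Finset.sum_comm]
            simp only [mul_assoc]
    rw [h1, h2, Finset.sum_congr rfl fun _ _ => Finset.sum_congr rfl fun _ _ => Finset.mul_sum _ _ _]
    rw [Finset.sum_congr rfl fun _ _ => Finset.sum_comm, Finset.sum_comm]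
    simp only [h3]
    ring
  | cons x l ih =>
    intro c Φ hΦ
    obtain ⟨k, r⟩ := x
    have h1 : ∀ s m, R.createAux (l ++ (p, i) :: (q, j) :: w) m
        (fun k' v => R.R12 k k' (r, m) (s, c) * Φ k' ((k, s) :: v)) =
        ∑ i', ∑ j', R.R12 p q (i, j) (i', j') *
          R.createAux (l ++ (q, j') :: (p, i') :: w) m
            (fun k' v => R.R12 k k' (r, m) (s, c) * Φ k' ((k, s) :: v)) := by
      intro s m
      refine ih m _ fun k' => ?_
      exact R.Fock.smul_mem _ (R.annihilate s k ⟨Φ k', hΦ k'⟩).2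
    simp only [List.cons_append, createAux, h1, mul_add, Finset.sum_add_distrib]
    congr 1
    · split_ifs
      · exact hΦ k l w p q i j
      · simp
    · simp only [Finset.mul_sum]
      rw [Finset.sum_congr rfl fun _ _ => Finset.sum_comm, Finset.sum_comm]
      refine Finset.sum_congr rfl fun i' _ => ?_
      rw [Finset.sum_congr rfl fun _ _ => Finset.sum_comm, Finset.sum_comm]

/-- The creation operators as operator-valued distributions: `create j Φ = ∫ dk a†_j(k) Φ(k)`. -/
def create (j : Fin N) : (ℝ → R.Fock) →ₗ[ℂ] R.Fock where
  toFun Φ := ⟨fun w => R.createAux w j (fun k => (Φ k).1), fun l l' p q i i' =>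
    R.createAux_symm l l' p q i i' j _ fun k => (Φ k).2⟩
  map_add' Φ Ψ := Subtype.ext <| funext fun w =>
    R.createAux_add w j (fun k => (Φ k).1) (fun k => (Ψ k).1)
  map_smul' c Φ := Subtype.ext <| funext fun w =>
    R.createAux_smul w j c (fun k => (Φ k).1)

/-! ## The well-bred vertex operator -/

/-- `L(k)` is well-bred: `L₁(k₁) a₂(k₂) = R₂₁(k₂,k₁) a₂(k₂) L₁(k₁)` and
`L₁(k₁) a†₂(k₂) = a†₂(k₂) R₁₂(k₁,k₂) L₁(k₁)`. -/
structure IsWellBred (L : ℝ → Matrix (Fin N) (Fin N) (Module.End ℂ R.Fock)) : Prop where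
  L_a : ∀ (k₁ k₂ : ℝ) (i i' j : Fin N),
    L k₁ i i' * R.annihilate j k₂ =
      ∑ s, ∑ j', R.R21 k₂ k₁ (i, j) (s, j') • (R.annihilate j' k₂ * L k₁ s i')
  L_adag : ∀ (k₁ : ℝ) (i i' j : Fin N) (Φ : ℝ → R.Fock),
    L k₁ i i' (R.create j Φ) =
      ∑ s, ∑ j', R.create j' (fun k₂ => R.R12 k₁ k₂ (i, j') (s, j) • L k₁ s i' (Φ k₂))

/-- `∫ dk₁ ⋯ dkₙ ∑ a†_{αₙ}(kₙ) ⋯ a†_{α₁}(k₁) M_{α₁β₁…αₙβₙ}(k₁,…,kₙ) a_{β₁}(k₁) ⋯ a_{βₙ}(kₙ)`, the sum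
being over all `α` and `β`; the entry `M_{α₁β₁…αₙβₙ}(k₁,…,kₙ)` is the value of `M` on the list
`[(k₁,α₁,β₁), …, (kₙ,αₙ,βₙ)]`. -/
def vertexTerm : ℕ → (List (ℝ × Fin N × Fin N) → ℂ) → Module.End ℂ R.Fock
  | 0, M => M [] • LinearMap.id
  | n + 1, M => ∑ α, ∑ β, R.create α ∘ₗ LinearMap.pi fun k =>
      vertexTerm n (fun l => M (l ++ [(k, α, β)])) ∘ₗ R.annihilate β k

/-- `T` has the form of a vertex operator: for some numerical matrices `T⁽ⁿ⁾(k₀, k₁, …, kₙ)`,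
`T(k₀) = 𝕀 + ∑_{n ≥ 1} (-1)ⁿ / (n-1)! ∫ dk₁ ⋯ dkₙ a†_{n…1} T⁽ⁿ⁾_{01…n} a_{1…n}`,
the series converging on every component of every Fock vector. -/
def IsVertexOperator (T : ℝ → Matrix (Fin N) (Fin N) (Module.End ℂ R.Fock)) : Prop :=
  ∃ K : ℝ → Fin N → Fin N → List (ℝ × Fin N × Fin N) → ℂ,
    ∀ (k₀ : ℝ) (α β : Fin N) (φ : R.Fock) (w : Word N),
      HasSum
        (fun n : ℕ => (-1 : ℂ) ^ (n + 1) / (Nat.factorial n : ℂ) *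
          (R.vertexTerm (n + 1) (K k₀ α β) φ).1 w)
        ((T k₀ α β φ).1 w - if α = β then φ.1 w else 0)

/-! ## The boundary generators -/

/-- `b(k) = T(k) B(k) T(-k)⁻¹` -/
def reflectionOp (T : ℝ → Matrix (Fin N) (Fin N) (Module.End ℂ R.Fock))
    (B : ℝ → Matrix (Fin N) (Fin N) ℂ) (k : ℝ) : Matrix (Fin N) (Fin N) (Module.End ℂ R.Fock) :=
  T k * scalarOp R.Fock (B k) * Ring.inverse (T (-k))

/-- `ã(k) = ½ (a(k) + b(k) a(-k))` -/
def boundaryA (b : ℝ → Matrix (Fin N) (Fin N) (Module.End ℂ R.Fock)) (i : Fin N) (k : ℝ) :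
    Module.End ℂ R.Fock :=
  (1 / 2 : ℂ) • (R.annihilate i k + ∑ j, b k i j * R.annihilate j (-k))

/-- `ã†(k) = ½ (a†(k) + a†(-k) b(-k))`. The second term is
`∫ dk a†_j(-k) b_{ji}(-k) Φ(k) = ∫ dk a†_j(k) b_{ji}(k) Φ(-k)`. -/
def boundaryAdag (b : ℝ → Matrix (Fin N) (Fin N) (Module.End ℂ R.Fock)) (i : Fin N) :
    (ℝ → R.Fock) →ₗ[ℂ] R.Fock :=
  (1 / 2 : ℂ) • (R.create i +
    ∑ j, R.create j ∘ₗ LinearMap.pi fun k => b k j i ∘ₗ LinearMap.proj (-k))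

/-- `ã(k) = b(k) ã(-k)` and `ã†(k) = ã†(-k) b(-k)` -/
structure ReflectionInvariant {V : Type*} [AddCommGroup V] [Module ℂ V]
    (a : Fin N → ℝ → Module.End ℂ V) (adag : Fin N → (ℝ → V) →ₗ[ℂ] V)
    (b : ℝ → Matrix (Fin N) (Fin N) (Module.End ℂ V)) : Prop where
  a_eq : ∀ (i : Fin N) (k : ℝ), a i k = ∑ j, b k i j * a j (-k)
  adag_eq : ∀ (i : Fin N) (Φ : ℝ → V), adag i Φ = ∑ j, adag j (fun k => b k j i (Φ (-k)))

end RMatrix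
end

/-!
The Fock space is graded by the number of particles, and a Fock vector is determined by its vacuum
component together with its images under all annihilators `a_j(k)`. An identity between operators
therefore holds as soon as both sides agree on vacuum components and obey the same recursion when
an annihilator is moved through them; the basic identities on the Fock space below are inductions
of this kind on the length of a word, whose step rests on the Yang-Baxter equation, on unitarity,
or on both. No analysis enters, because each component of `∫ dk a†(k) Φ(k)` is a finite
sum.

*The vertex operator.* The exchange relation with the annihilators, solved for `a_j(k) T(k₀)`,
reads `a₂(k) T₁(k₀) = R₁₂(k₀, k) T₁(k₀) a₂(k)`. Normal ordering forces `T` to be the identity on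
vacuum components, hence `T(k₀)` acts on `n` particles as `R₀₁(k₀, k₁) ⋯ R₀ₙ(k₀, kₙ)`: this gives
uniqueness (`RMatrix.eq_vertex`) and a candidate `RMatrix.vertex`. Its inverse acts by the inverse
product; both are instances of `RMatrix.Exchanges.op`. The relation with the creators
(`RMatrix.vertex_creation`) and `R₁₂ T₁ T₂ = T₂ T₁ R₁₂` (`RMatrix.R12_vertex_vertex`) are
inductions as above.

That the candidate has a normally ordered expansion is a general fact on operators which, like `T`
and like every normally ordered term, are *local*: a component of the image depends only on the
components of the argument with the same momenta. A local operator is a matrix multiplication in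
the labels (`RMatrix.IsLocal.exists_labelSum`, a dimension argument). On `n` particles the
normally ordered term with `n` annihilators and this matrix as kernel is `n!` times the matrix
multiplication, because `∑ ∫ dk a†(k) a(k)` counts particles (`RMatrix.sum_component_vertexTerm`).
So the kernels can be chosen one degree after the other, each correcting the remainder of the
previous ones (`RMatrix.IsLocal.exists_expansion`).

*The boundary algebra.* From the relations of `T`, the operator `b = T B T⁻¹` inherits the
reflection equation of `B`, and exchanges with `a` and `a†` as the boundary algebra demands with
`ã`, `ã†` replaced by `a`, `a†` (`RMatrix.isReflectionOp_reflectionOp`). The relations of `ã` and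
`ã†` then follow by expanding both sides: each of the four terms on one side is brought to the
form of a term on the other by an exchange relation, the reflection equation, or unitarity. To
keep indices out of this computation, the generators are regarded as maps between `V`, `V ⊗ ℂ^N`
and `V ⊗ ℂ^N ⊗ ℂ^N`.
-/

open scoped Kronecker

noncomputable section

namespace RMatrix

variable {N : ℕ} (R : RMatrix N)
variable {V W : Type*} [AddCommGroup V] [Module ℂ V] [AddCommGroup W] [Module ℂ W]

/-! ### Numerical matrices acting on tensor legs -/

/-- The action of a numerical matrix on a `V`-valued tensor with two legs, in curried form. Actions
on two legs of a tensor with more legs are obtained by fixing the other indices. -/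
def legAct (M : Matrix (Fin N × Fin N) (Fin N × Fin N) ℂ) (v : Fin N → Fin N → V)
    (i j : Fin N) : V :=
  ∑ i', ∑ j', M (i, j) (i', j') • v i' j'

theorem legAct_eq_sum (M : Matrix (Fin N × Fin N) (Fin N × Fin N) ℂ) (v : Fin N → Fin N → V)
    (i j : Fin N) : legAct M v i j = ∑ p : Fin N × Fin N, M (i, j) p • v p.1 p.2 :=
  (Fintype.sum_prod_type' fun a b => M (i, j) (a, b) • v a b).symm

theorem map_legAct (f : V →ₗ[ℂ] W) (M : Matrix (Fin N × Fin N) (Fin N × Fin N) ℂ)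
    (v : Fin N → Fin N → V) (i j : Fin N) :
    f (legAct M v i j) = legAct M (fun a b => f (v a b)) i j := by
  simp only [legAct, map_sum, map_smul]

theorem legAct_add (M : Matrix (Fin N × Fin N) (Fin N × Fin N) ℂ) (v v' : Fin N → Fin N → V)
    (i j : Fin N) :
    legAct M (fun a b => v a b + v' a b) i j = legAct M v i j + legAct M v' i j := by
  simp only [legAct, smul_add, Finset.sum_add_distrib]

theorem legAct_sum {ι : Type*} (s : Finset ι) (M : Matrix (Fin N × Fin N) (Fin N × Fin N) ℂ)
    (v : ι → Fin N → Fin N → V) (i j : Fin N) :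
    legAct M (fun a b => ∑ x ∈ s, v x a b) i j = ∑ x ∈ s, legAct M (v x) i j := by
  simp only [legAct, Finset.smul_sum]
  rw [Finset.sum_congr rfl fun _ _ => Finset.sum_comm, Finset.sum_comm]

theorem legAct_smul (M : Matrix (Fin N × Fin N) (Fin N × Fin N) ℂ) (c : ℂ)
    (v : Fin N → Fin N → V) (i j : Fin N) :
    legAct M (fun a b => c • v a b) i j = c • legAct M v i j := by
  simp only [legAct, Finset.smul_sum, smul_comm c]

theorem legAct_apply {X : Type*} (M : Matrix (Fin N × Fin N) (Fin N × Fin N) ℂ)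
    (v : Fin N → Fin N → X → V) (i j : Fin N) (x : X) :
    legAct M v i j x = legAct M (fun a b => v a b x) i j := by
  simp only [legAct, Finset.sum_apply, Pi.smul_apply]

/-- Actions on disjoint pairs of legs commute. -/
theorem legAct_comm (M M' : Matrix (Fin N × Fin N) (Fin N × Fin N) ℂ)
    (v : Fin N → Fin N → Fin N → Fin N → V) (i j k l : Fin N) :
    legAct M (fun a b => legAct M' (fun c d => v a b c d) k l) i j =
      legAct M' (fun c d => legAct M (fun a b => v a b c d) i j) k l := by
  simp only [legAct_eq_sum, Finset.smul_sum]
  rw [Finset.sum_comm]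
  exact Finset.sum_congr rfl fun _ _ => Finset.sum_congr rfl fun _ _ => smul_comm _ _ _

theorem legAct_flipLegs (M : Matrix (Fin N × Fin N) (Fin N × Fin N) ℂ)
    (v : Fin N → Fin N → V) (i j : Fin N) :
    legAct (flipLegs M) v i j = legAct M (fun a b => v b a) j i := by
  simp only [legAct, flipLegs, Matrix.submatrix_apply, Prod.swap_prod_mk]
  exact Finset.sum_comm

theorem legAct_R21 (p q : ℝ) (v : Fin N → Fin N → V) (i j : Fin N) :
    legAct (R.R21 p q) v i j = legAct (R.R12 p q) (fun a b => v b a) j i :=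
  legAct_flipLegs _ _ _ _

theorem legAct_one (v : Fin N → Fin N → V) (i j : Fin N) :
    legAct (1 : Matrix (Fin N × Fin N) (Fin N × Fin N) ℂ) v i j = v i j := by
  simp [legAct_eq_sum, Matrix.one_apply]

theorem legAct_mul (M M' : Matrix (Fin N × Fin N) (Fin N × Fin N) ℂ)
    (v : Fin N → Fin N → V) (i j : Fin N) :
    legAct (M * M') v i j = legAct M (fun a b => legAct M' v a b) i j := by
  simp only [legAct_eq_sum, Matrix.mul_apply, Finset.sum_smul, Finset.smul_sum, mul_smul]
  exact Finset.sum_comm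

theorem R21_mul_R12 (p q : ℝ) : R.R21 p q * R.R12 q p = 1 :=
  mul_eq_one_comm.mp (R.unitarity q p)

theorem R12_mul_R21 (p q : ℝ) : R.R12 p q * R.R21 q p = 1 := R.unitarity p q

theorem legAct_R12_R21 (p q : ℝ) (v : Fin N → Fin N → V) (i j : Fin N) :
    legAct (R.R12 p q) (fun a b => legAct (R.R21 q p) v a b) i j = v i j := by
  rw [← legAct_mul, R12_mul_R21, legAct_one]

/-- The Yang-Baxter equation as an identity between actions on `V`-valued tensors with three
legs. -/
theorem yangBaxter_legAct (p q r : ℝ) (v : Fin N → Fin N → Fin N → V) (i j k : Fin N) :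
    legAct (R.R12 p q) (fun i₁ j₁ => legAct (R.R12 p r) (fun i₂ k₁ =>
        legAct (R.R12 q r) (fun j₂ k₂ => v i₂ j₂ k₂) j₁ k₁) i₁ k) i j =
      legAct (R.R12 q r) (fun j₁ k₁ => legAct (R.R12 p r) (fun i₁ k₂ =>
        legAct (R.R12 p q) (fun i₂ j₂ => v i₂ j₂ k₂) i₁ j₁) i k₁) j k := by
  have key (A B : Matrix (Fin N × Fin N × Fin N) (Fin N × Fin N × Fin N) ℂ) (u : _ → V) (x) :
      ∑ y, (A * B) x y • u y = ∑ y, A x y • ∑ z, B y z • u z := by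
    simp only [Matrix.mul_apply, Finset.sum_smul, Finset.smul_sum, mul_smul]
    exact Finset.sum_comm
  have h12 (M : Matrix (Fin N × Fin N) (Fin N × Fin N) ℂ) (u : _ → V) (x) :
      ∑ y, emb12 M x y • u y = legAct M (fun a b => u (a, b, x.2.2)) x.1 x.2.1 := by
    simp [emb12, Fintype.sum_prod_type, legAct, ite_smul]
  have h13 (M : Matrix (Fin N × Fin N) (Fin N × Fin N) ℂ) (u : _ → V) (x) :
      ∑ y, emb13 M x y • u y = legAct M (fun a b => u (a, x.2.1, b)) x.1 x.2.2 := by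
    simp [emb13, Fintype.sum_prod_type, legAct, ite_smul, Finset.sum_ite_irrel]
  have h23 (M : Matrix (Fin N × Fin N) (Fin N × Fin N) ℂ) (u : _ → V) (x) :
      ∑ y, emb23 M x y • u y = legAct M (fun a b => u (x.1, a, b)) x.2.1 x.2.2 := by
    simp [emb23, Fintype.sum_prod_type, legAct, ite_smul, Finset.sum_ite_irrel]
  have h := congrArg (fun A => ∑ y, A (i, j, k) y • v y.1 y.2.1 y.2.2) (R.yangBaxter p q r)
  simpa only [Matrix.mul_assoc, key, h12, h13, h23] using h

/-! ### The relations of the ZF algebra on the Fock space -/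

/-- A component of a Fock vector, as a linear form. -/
def component (w : Word N) : R.Fock →ₗ[ℂ] ℂ := LinearMap.proj w ∘ₗ R.Fock.subtype

theorem component_cons (k : ℝ) (i : Fin N) (w : Word N) (φ : R.Fock) :
    R.component ((k, i) :: w) φ = R.component w (R.annihilate i k φ) := rfl

variable {R} in
theorem Fock.ext_component {φ ψ : R.Fock} (h : ∀ w, R.component w φ = R.component w ψ) : φ = ψ :=
  Subtype.ext (funext h)

/-- `∑ⱼ ∫ dk a†_j(k) Φ_j(k)` -/
def creation (adag : Fin N → (ℝ → V) →ₗ[ℂ] V) : (ℝ → Fin N → V) →ₗ[ℂ] V :=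
  ∑ j, adag j ∘ₗ LinearMap.pi fun k => LinearMap.proj j ∘ₗ LinearMap.proj k

theorem creation_apply (adag : Fin N → (ℝ → V) →ₗ[ℂ] V) (Φ : ℝ → Fin N → V) :
    creation adag Φ = ∑ j, adag j (fun k => Φ k j) := by
  simp only [creation, LinearMap.sum_apply]
  rfl

theorem legAct_creation (adag : Fin N → (ℝ → V) →ₗ[ℂ] V)
    (M : Matrix (Fin N × Fin N) (Fin N × Fin N) ℂ) (Φ : Fin N → Fin N → ℝ → Fin N → V)
    (i j : Fin N) :
    legAct M (fun a b => creation adag (Φ a b)) i j =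
      creation adag (fun k c => legAct M (fun a b => Φ a b k c) i j) := by
  rw [← map_legAct]
  congr 1
  funext k c
  rw [legAct_apply, legAct_apply]

theorem creation_add (adag : Fin N → (ℝ → V) →ₗ[ℂ] V) (Φ Ψ : ℝ → Fin N → V) :
    creation adag (fun k j => Φ k j + Ψ k j) = creation adag Φ + creation adag Ψ :=
  map_add (creation adag) Φ Ψ

theorem component_nil_create (j : Fin N) (Φ : ℝ → R.Fock) :
    R.component [] (R.create j Φ) = 0 := rfl

theorem component_nil_creation (Φ : ℝ → Fin N → R.Fock) :
    R.component [] (creation R.create Φ) = 0 := by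
  simp [creation_apply, component_nil_create]

theorem annihilate_create (k : ℝ) (i j : Fin N) (Φ : ℝ → R.Fock) :
    R.annihilate i k (R.create j Φ) =
      (∑ i', ∑ j', R.create j' (fun k₂ => R.R12 k k₂ (i, j') (i', j) • R.annihilate i' k (Φ k₂)))
        + (if i = j then Φ k else 0) := by
  refine Fock.ext_component fun w => ?_
  simp only [map_add, map_sum, ← component_cons]
  rw [add_comm]
  change R.createAux ((k, i) :: w) j (fun k => (Φ k).1) = _
  rw [createAux]
  congr 1
  split_ifs <;> rfl

theorem annihilate_creation (k : ℝ) (i : Fin N) (Φ : ℝ → Fin N → R.Fock) :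
    R.annihilate i k (creation R.create Φ) =
      creation R.create (fun k₂ j => legAct (R.R12 k k₂)
        (fun i' j' => R.annihilate i' k (Φ k₂ j')) i j) + Φ k i := by
  simp only [creation_apply, map_sum, annihilate_create, Finset.sum_add_distrib,
    Finset.sum_ite_eq, Finset.mem_univ, if_true]
  congr 1
  have h (j : Fin N) (f : Fin N → Fin N → ℝ → R.Fock) :
      R.create j (fun k => ∑ a, ∑ b, f a b k) = ∑ a, ∑ b, R.create j (f a b) := by
    simp only [← map_sum]
    congr 1
    funext k
    simp
  simp only [legAct, h]
  rw [Finset.sum_comm]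
  conv_rhs => rw [Finset.sum_comm]
  refine Finset.sum_congr rfl fun a _ => ?_
  rw [Finset.sum_comm, Finset.sum_comm' (t' := Finset.univ) (s' := fun _ => Finset.univ) (by simp)]

/-- The symmetry of Fock vectors in the first two places is the exchange relation of the
annihilators. -/
theorem annihilate_annihilate (p q : ℝ) (i j : Fin N) (φ : R.Fock) :
    R.annihilate j q (R.annihilate i p φ) =
      legAct (R.R12 p q) (fun i' j' => R.annihilate i' p (R.annihilate j' q φ)) i j := by
  refine Fock.ext_component fun w => ?_
  rw [map_legAct]
  exact φ.2 [] w p q i j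

/-- The relation `a†₁(k₁) a†₂(k₂) = a†₂(k₂) a†₁(k₁) R₂₁(k₂, k₁)`. Moving an annihilator through both
sides gives on each a term with two creators, compared by the Yang-Baxter equation and the
hypothesis of induction, and two terms with one creator, compared by unitarity. -/
theorem creation_creation (Φ : ℝ → ℝ → Fin N → Fin N → R.Fock) :
    creation R.create (fun k₁ i => creation R.create (fun k₂ j => Φ k₁ k₂ i j)) =
      creation R.create (fun k₂ j => creation R.create (fun k₁ i =>
        legAct (R.R21 k₂ k₁) (Φ k₁ k₂) i j)) := by
  refine Fock.ext_component fun w => ?_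
  induction w generalizing Φ with
  | nil => rw [component_nil_creation, component_nil_creation]
  | cons x w ih =>
    obtain ⟨k, c⟩ := x
    simp only [component_cons, annihilate_creation, legAct_add, legAct_creation,
      creation_add]
    simp only [map_add]
    rw [ih]
    have h1 (k₂ : ℝ) : legAct (R.R12 k k₂) (legAct (R.R21 k₂ k) (Φ k k₂)) c = Φ k k₂ c :=
      funext fun j => R.legAct_R12_R21 k k₂ (Φ k k₂) c j
    have h2 := fun k₁ k₂ j i => R.yangBaxter_legAct k k₁ k₂
      (fun a b d => R.annihilate a k (Φ k₂ k₁ d b)) c j i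
    simp only [h1]
    simp only [legAct_R21, map_legAct, h2]
    exact add_right_comm _ _ _

/-! ### Operators that act by transporting an auxiliary leg through the particles -/

/-- `transport Q w α β` is the linear form `φ ↦ (Q₀₁(k₁) ⋯ Q₀ₙ(kₙ) φ(k₁, …, kₙ))` at the labels `w`,
with entry `(α, β)` in the auxiliary leg `0`. -/
def transport (Q : ℝ → Matrix (Fin N × Fin N) (Fin N × Fin N) ℂ) :
    Word N → Fin N → Fin N → ((Word N → ℂ) →ₗ[ℂ] ℂ)
  | [], α, β => if α = β then LinearMap.proj [] else 0
  | (k, j) :: w, α, β => legAct (Q k) (fun s j' =>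
      transport Q w s β ∘ₗ LinearMap.funLeft ℂ ℂ (List.cons (k, j'))) α j

theorem transport_cons (Q : ℝ → Matrix (Fin N × Fin N) (Fin N × Fin N) ℂ) (k : ℝ) (j : Fin N)
    (w : Word N) (α β : Fin N) (φ : Word N → ℂ) :
    transport Q ((k, j) :: w) α β φ = legAct (Q k) (fun s j' =>
      transport Q w s β (fun v => φ ((k, j') :: v))) α j :=
  map_legAct (LinearMap.applyₗ φ) _ _ _ _

/-- The family `Q` satisfies the exchange relation
`Q₀₁(p) Q₀₂(q) R₁₂(p,q) = R₁₂(p,q) Q₀₂(q) Q₀₁(p)` that makes `transport Q` compatible with the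
symmetry of the Fock space. -/
def Exchanges (Q : ℝ → Matrix (Fin N × Fin N) (Fin N × Fin N) ℂ) : Prop :=
  ∀ (p q : ℝ) (v : Fin N → Fin N → Fin N → ℂ) (α i j : Fin N),
    legAct (Q p) (fun s i' => legAct (Q q) (fun t j' =>
        legAct (R.R12 p q) (fun x y => v t x y) i' j') s j) α i =
      legAct (R.R12 p q) (fun i' j' => legAct (Q q) (fun s y =>
        legAct (Q p) (fun t x => v t x y) s i') α j') i j

theorem exchanges_R12 (k₀ : ℝ) : R.Exchanges (R.R12 k₀) := fun p q v α i j =>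
  R.yangBaxter_legAct k₀ p q v α i j

variable {R} in
theorem Exchanges.transport_symm {Q : ℝ → Matrix (Fin N × Fin N) (Fin N × Fin N) ℂ}
    (hQ : R.Exchanges Q) (l w : Word N) (p q : ℝ) (i j : Fin N) :
    ∀ (α β : Fin N) (φ : R.Fock), transport Q (l ++ (p, i) :: (q, j) :: w) α β φ.1 =
      legAct (R.R12 p q)
        (fun i' j' => transport Q (l ++ (q, j') :: (p, i') :: w) α β φ.1) i j := by
  induction l with
  | nil =>
    intro α β φ
    have h (i' j' : Fin N) (v : Word N) : φ.1 ((p, i') :: (q, j') :: v) =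
        legAct (R.R12 p q) (fun x y => φ.1 ((q, y) :: (p, x) :: v)) i' j' :=
      φ.2 [] v p q i' j'
    have h' (i' j' : Fin N) : (fun v => φ.1 ((p, i') :: (q, j') :: v)) =
        legAct (R.R12 p q) (fun x y v => φ.1 ((q, y) :: (p, x) :: v)) i' j' := by
      funext v
      rw [h, legAct_apply]
    simp only [List.nil_append, transport_cons, h', map_legAct]
    exact hQ p q _ _ _ _
  | cons x l ih =>
    intro α β φ
    obtain ⟨k, r⟩ := x
    have h (s r' : Fin N) := ih s β (R.annihilate r' k φ)
    simp only [List.cons_append, transport_cons]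
    exact (congrArg (fun f => legAct (Q k) f α r) (funext₂ h)).trans (legAct_comm _ _ _ _ _ _ _)

variable {R} in
/-- The entry `(α, β)` of the matrix of operators on the Fock space that acts on the `n`-particle
component as `Q₀₁(k₁) ⋯ Q₀ₙ(kₙ)`. -/
def Exchanges.op {Q : ℝ → Matrix (Fin N × Fin N) (Fin N × Fin N) ℂ} (hQ : R.Exchanges Q)
    (α β : Fin N) : Module.End ℂ R.Fock where
  toFun φ := ⟨fun w => transport Q w α β φ.1, fun l w p q i j =>
    hQ.transport_symm l w p q i j α β φ⟩
  map_add' φ ψ := Subtype.ext <| funext fun w => map_add (transport Q w α β) φ.1 ψ.1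
  map_smul' c φ := Subtype.ext <| funext fun w => map_smul (transport Q w α β) c φ.1

variable {R} in
theorem Exchanges.component_nil_op {Q : ℝ → Matrix (Fin N × Fin N) (Fin N × Fin N) ℂ}
    (hQ : R.Exchanges Q) (α β : Fin N) (φ : R.Fock) :
    R.component [] (hQ.op α β φ) = if α = β then R.component [] φ else 0 := by
  change transport Q [] α β φ.1 = _
  rw [transport]
  split_ifs <;> rfl

variable {R} in
theorem Exchanges.annihilate_op {Q : ℝ → Matrix (Fin N × Fin N) (Fin N × Fin N) ℂ}
    (hQ : R.Exchanges Q) (α β : Fin N) (k : ℝ) (j : Fin N) (φ : R.Fock) :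
    R.annihilate j k (hQ.op α β φ) =
      legAct (Q k) (fun s j' => hQ.op s β (R.annihilate j' k φ)) α j := by
  refine Fock.ext_component fun w => ?_
  rw [map_legAct]
  exact transport_cons Q k j w α β φ.1

/-! ### The vertex operator, its inverse, and its exchange relations -/

/-- The transpose in the auxiliary leg of a matrix whose second leg is the auxiliary one; the
auxiliary leg of the result comes first. -/
def auxTranspose (A : Matrix (Fin N × Fin N) (Fin N × Fin N) ℂ) :
    Matrix (Fin N × Fin N) (Fin N × Fin N) ℂ :=
  Matrix.of fun x y => A (x.2, y.1) (y.2, x.1)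

theorem legAct_auxTranspose (A : Matrix (Fin N × Fin N) (Fin N × Fin N) ℂ)
    (v : Fin N → Fin N → V) (α j : Fin N) :
    legAct (auxTranspose A) v α j =
      ∑ t, legAct A (fun j' c => if c = α then v t j' else 0) j t := by
  simp [legAct, auxTranspose]

theorem sum_legAct_auxTranspose (A : Matrix (Fin N × Fin N) (Fin N × Fin N) ℂ)
    (v : Fin N → Fin N → Fin N → V) (j : Fin N) :
    ∑ s, legAct (auxTranspose A) (fun t j' => v t j' s) s j =
      ∑ t, legAct A (fun j' s => v t j' s) j t := by
  simp only [legAct, auxTranspose, Matrix.of_apply]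
  rw [Finset.sum_comm]
  exact Finset.sum_congr rfl fun _ _ => Finset.sum_comm

/-- Two transposed actions that share the auxiliary leg compose in the reverse order. -/
theorem legAct_auxTranspose_auxTranspose (A B : Matrix (Fin N × Fin N) (Fin N × Fin N) ℂ)
    (v : Fin N → Fin N → Fin N → V) (α i j : Fin N) :
    legAct (auxTranspose A) (fun s i' => legAct (auxTranspose B) (fun t j' => v t i' j') s j) α i =
      ∑ t, legAct B (fun j' s =>
        legAct A (fun i' c => if c = α then v t i' j' else 0) i s) j t := by
  rw [← sum_legAct_auxTranspose B fun t j' s =>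
    legAct A (fun i' c => if c = α then v t i' j' else 0) i s, legAct_auxTranspose]
  refine Finset.sum_congr rfl fun s _ => ?_
  have h (i' c : Fin N) : (if c = α then legAct (auxTranspose B) (fun t j' => v t i' j') s j
      else 0) = legAct (auxTranspose B) (fun t j' => if c = α then v t i' j' else 0) s j := by
    split_ifs <;> simp [legAct]
  simp only [h]
  exact legAct_comm _ _ _ _ _ _ _

/-- The kernel of the inverse vertex operator: `R₂₁(k, k₀)`, transposed in the auxiliary leg. -/
def inverseKernel (k₀ k : ℝ) : Matrix (Fin N × Fin N) (Fin N × Fin N) ℂ :=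
  auxTranspose (R.R12 k k₀)

/-- After the transposition is undone, the exchange relation of the kernel of `T(k₀)⁻¹` is the
Yang-Baxter equation with `k₀` as the last spectral parameter. -/
theorem exchanges_inverseKernel (k₀ : ℝ) : R.Exchanges (R.inverseKernel k₀) := by
  intro p q v α i j
  have h (t : Fin N) := R.yangBaxter_legAct p q k₀
    (fun x y c => if c = α then v t x y else 0) i j t
  have hite (t c i' j' : Fin N) : (if c = α then legAct (R.R12 p q) (fun x y => v t x y) i' j'
      else 0) = legAct (R.R12 p q) (fun x y => if c = α then v t x y else 0) i' j' := by
    split_ifs <;> simp [legAct]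
  have hr (i' j' : Fin N) := legAct_auxTranspose_auxTranspose (R.R12 q k₀) (R.R12 p k₀)
    (fun t y x => v t x y) α j' i'
  simp only [inverseKernel, legAct_auxTranspose_auxTranspose (R.R12 p k₀) (R.R12 q k₀)
    (fun t i' j' => legAct (R.R12 p q) (fun x y => v t x y) i' j'), hr, hite, ← h, legAct_sum]

/-- The matrix of operators `T(k₀)` acting as `R₀₁(k₀, k₁) ⋯ R₀ₙ(k₀, kₙ)`. -/
def vertex (k₀ : ℝ) : Matrix (Fin N) (Fin N) (Module.End ℂ R.Fock) :=
  Matrix.of (R.exchanges_R12 k₀).op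

/-- The matrix of operators acting as `Rₙ₀(kₙ, k₀) ⋯ R₁₀(k₁, k₀)`. The factors stand in the order
opposite to that of `Exchanges.op`, so the auxiliary leg is transposed in the kernel and the matrix
is transposed back at the end. -/
def vertexInv (k₀ : ℝ) : Matrix (Fin N) (Fin N) (Module.End ℂ R.Fock) :=
  (Matrix.of (R.exchanges_inverseKernel k₀).op).transpose

theorem component_nil_vertex (k₀ : ℝ) (α β : Fin N) (φ : R.Fock) :
    R.component [] (R.vertex k₀ α β φ) = if α = β then R.component [] φ else 0 :=
  Exchanges.component_nil_op (R.exchanges_R12 k₀) _ _ _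

theorem annihilate_vertex (k₀ : ℝ) (α β : Fin N) (k : ℝ) (j : Fin N) (φ : R.Fock) :
    R.annihilate j k (R.vertex k₀ α β φ) =
      legAct (R.R12 k₀ k) (fun s j' => R.vertex k₀ s β (R.annihilate j' k φ)) α j :=
  Exchanges.annihilate_op (R.exchanges_R12 k₀) _ _ _ _ _

theorem component_nil_vertexInv (k₀ : ℝ) (α β : Fin N) (φ : R.Fock) :
    R.component [] (R.vertexInv k₀ α β φ) = if β = α then R.component [] φ else 0 :=
  Exchanges.component_nil_op (R.exchanges_inverseKernel k₀) _ _ _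

theorem annihilate_vertexInv (k₀ : ℝ) (α β : Fin N) (k : ℝ) (j : Fin N) (φ : R.Fock) :
    R.annihilate j k (R.vertexInv k₀ α β φ) =
      legAct (R.inverseKernel k₀ k)
        (fun s j' => R.vertexInv k₀ α s (R.annihilate j' k φ)) β j :=
  Exchanges.annihilate_op (R.exchanges_inverseKernel k₀) _ _ _ _ _

theorem sum_inverseKernel_R12 (k₀ k : ℝ) (v : Fin N → Fin N → Fin N → V) (j : Fin N) :
    ∑ s, legAct (R.inverseKernel k₀ k) (fun t j' => legAct (R.R12 k₀ k)
      (fun u j'' => v t u j'') s j') s j = ∑ t, v t t j := by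
  rw [inverseKernel, sum_legAct_auxTranspose (R.R12 k k₀) fun t j' s =>
    legAct (R.R12 k₀ k) (fun u j'' => v t u j'') s j']
  refine Finset.sum_congr rfl fun t _ => ?_
  simpa only [legAct_R21] using R.legAct_R12_R21 k k₀ (fun j' s => v t s j') j t

theorem sum_R12_inverseKernel (k₀ k : ℝ) (v : Fin N → V) (α β j : Fin N) :
    legAct (R.R12 k₀ k) (fun s j' => legAct (R.inverseKernel k₀ k)
      (fun t j'' => if s = t then v j'' else 0) β j') α j = if α = β then v j else 0 := by
  have h (s j' : Fin N) : legAct (R.inverseKernel k₀ k)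
      (fun t j'' => if s = t then v j'' else 0) β j' =
      legAct (R.R21 k k₀) (fun c j'' => if c = β then v j'' else 0) s j' := by
    rw [legAct_R21]
    simp [inverseKernel, auxTranspose, legAct]
  simp only [h]
  exact R.legAct_R12_R21 k₀ k _ α j

theorem vertex_mul_vertexInv (k₀ : ℝ) : R.vertex k₀ * R.vertexInv k₀ = 1 := by
  suffices h : ∀ (w : Word N) (α β : Fin N) (φ : R.Fock),
      R.component w (∑ s, R.vertex k₀ α s (R.vertexInv k₀ s β φ)) =
        if α = β then R.component w φ else 0 by
    refine Matrix.ext fun α β => LinearMap.ext fun φ => Fock.ext_component fun w => ?_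
    rw [Matrix.mul_apply, LinearMap.sum_apply]
    refine (h w α β φ).trans ?_
    rw [Matrix.one_apply]
    split_ifs <;> rfl
  intro w
  induction w with
  | nil =>
    intro α β φ
    simp [map_sum, component_nil_vertex, component_nil_vertexInv, eq_comm]
  | cons x w ih =>
    intro α β φ
    obtain ⟨k, j⟩ := x
    simp only [component_cons, map_sum, annihilate_vertex, annihilate_vertexInv, map_legAct,
      ← legAct_sum]
    simp only [← map_sum, ih, sum_R12_inverseKernel]

theorem vertexInv_mul_vertex (k₀ : ℝ) : R.vertexInv k₀ * R.vertex k₀ = 1 := by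
  suffices h : ∀ (w : Word N) (α β : Fin N) (φ : R.Fock),
      R.component w (∑ s, R.vertexInv k₀ α s (R.vertex k₀ s β φ)) =
        if α = β then R.component w φ else 0 by
    refine Matrix.ext fun α β => LinearMap.ext fun φ => Fock.ext_component fun w => ?_
    rw [Matrix.mul_apply, LinearMap.sum_apply]
    refine (h w α β φ).trans ?_
    rw [Matrix.one_apply]
    split_ifs <;> rfl
  intro w
  induction w with
  | nil =>
    intro α β φ
    simp [map_sum, component_nil_vertex, component_nil_vertexInv, eq_comm]
  | cons x w ih =>
    intro α β φ
    obtain ⟨k, j⟩ := x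
    simp only [component_cons, map_sum, annihilate_vertex, annihilate_vertexInv, map_legAct]
    rw [sum_inverseKernel_R12 R k₀ k (fun t u j'' => R.component w
      (R.vertexInv k₀ α t (R.vertex k₀ u β (R.annihilate j'' k φ)))) j]
    simp only [← map_sum, ih]

/-- A matrix of operators obeying the exchange relation with the annihilators is determined by
its action on the vacuum components. -/
theorem eq_vertex {k₀ : ℝ} {L : Matrix (Fin N) (Fin N) (Module.End ℂ R.Fock)}
    (h_nil : ∀ α β φ, R.component [] (L α β φ) = if α = β then R.component [] φ else 0)
    (h : ∀ α β k j φ, R.annihilate j k (L α β φ) =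
      legAct (R.R12 k₀ k) (fun s j' => L s β (R.annihilate j' k φ)) α j) :
    L = R.vertex k₀ := by
  suffices h : ∀ (w : Word N) (α β : Fin N) (φ : R.Fock),
      R.component w (L α β φ) = R.component w (R.vertex k₀ α β φ) by
    exact Matrix.ext fun α β => LinearMap.ext fun φ => Fock.ext_component fun w => h w α β φ
  intro w
  induction w with
  | nil => intro α β φ; rw [h_nil, component_nil_vertex]
  | cons x w ih =>
    intro α β φ
    obtain ⟨k, j⟩ := x
    simp only [component_cons, annihilate_vertex, h, map_legAct, ih]

/-- The relation `T₁(k₁) a†₂(k₂) = a†₂(k₂) R₁₂(k₁, k₂) T₁(k₁)`. -/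
theorem vertex_creation (k₁ : ℝ) (α β : Fin N) (Φ : ℝ → Fin N → R.Fock) :
    R.vertex k₁ α β (creation R.create Φ) = creation R.create
      (fun k₂ => legAct (R.R12 k₁ k₂) (fun s j => R.vertex k₁ s β (Φ k₂ j)) α) := by
  refine Fock.ext_component fun w => ?_
  induction w generalizing α Φ with
  | nil => simp [component_nil_vertex, component_nil_creation]
  | cons x w ih =>
    obtain ⟨k, c⟩ := x
    have h2 := fun k₂ j => R.yangBaxter_legAct k₁ k k₂
      (fun a b d => R.vertex k₁ a β (R.annihilate b k (Φ k₂ d))) α c j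
    simp only [component_cons, annihilate_vertex, annihilate_creation,
      map_legAct (R.annihilate _ _), map_legAct (R.component _), map_add, legAct_add, ih]
    simp only [← map_legAct (R.component _), map_legAct (R.vertex _ _ _), legAct_creation, h2]

/-- The exchange relation `R₁₂ T₁ T₂ = T₂ T₁ R₁₂`. -/
theorem R12_vertex_vertex (k₁ k₂ : ℝ) (i j i' j' : Fin N) (φ : R.Fock) :
    legAct (R.R12 k₁ k₂) (fun s t => R.vertex k₁ s i' (R.vertex k₂ t j' φ)) i j =
      ∑ s, ∑ t, R.R12 k₁ k₂ (s, t) (i', j') • R.vertex k₂ j t (R.vertex k₁ i s φ) := by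
  refine Fock.ext_component fun w => ?_
  induction w generalizing i j φ with
  | nil =>
    simp only [map_legAct, map_sum, map_smul, component_nil_vertex]
    simp [legAct]
  | cons x w ih =>
    obtain ⟨k, c⟩ := x
    have h2 := R.yangBaxter_legAct k₁ k₂ k
      (fun a b d => R.component w (R.vertex k₁ a i' (R.vertex k₂ b j' (R.annihilate d k φ)))) i j c
    simp only [component_cons, map_legAct, map_sum, map_smul, annihilate_vertex] at ih ⊢
    rw [h2]
    simp only [ih]
    simp only [legAct_sum, legAct_smul]

/-! ### Operators that act within each set of momenta -/

/-- A creation operator adds one momentum: its value at `w` involves `Φ(k)` only at the words that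
together with `k` have the momenta of `w`. -/
theorem createAux_eq_zero (w : Word N) : ∀ (j : Fin N) (Φ : ℝ → Word N → ℂ),
    (∀ k v, (k :: v.map Prod.fst).Perm (w.map Prod.fst) → Φ k v = 0) →
      R.createAux w j Φ = 0 := by
  induction w with
  | nil => intro j Φ _; rfl
  | cons x w ih =>
    intro j Φ h
    obtain ⟨k, i⟩ := x
    have h1 : Φ k w = 0 := h k w (by simp)
    have h2 (s m : Fin N) : R.createAux w m
        (fun k' v => R.R12 k k' (i, m) (s, j) * Φ k' ((k, s) :: v)) = 0 := by
      refine ih m _ fun k' v hv => ?_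
      rw [h k' ((k, s) :: v) ((List.Perm.swap _ _ _).trans (hv.cons k)), mul_zero]
    simp [createAux, h1, h2]

theorem component_create_congr {w : Word N} (j : Fin N) {Φ Ψ : ℝ → R.Fock}
    (h : ∀ k v, (k :: v.map Prod.fst).Perm (w.map Prod.fst) →
      R.component v (Φ k) = R.component v (Ψ k)) :
    R.component w (R.create j Φ) = R.component w (R.create j Ψ) := by
  rw [← sub_eq_zero, ← map_sub, ← map_sub]
  refine R.createAux_eq_zero w j _ fun k v hv => ?_
  exact sub_eq_zero.mpr (h k v hv)

theorem component_create_eq_zero {w : Word N} (j : Fin N) {Φ : ℝ → R.Fock}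
    (h : ∀ k v, (k :: v.map Prod.fst).Perm (w.map Prod.fst) → R.component v (Φ k) = 0) :
    R.component w (R.create j Φ) = 0 :=
  R.createAux_eq_zero w j _ h

/-- `φ` vanishes on all words whose momenta are, up to order, those in `s`. -/
def VanishesAt (s : List ℝ) (φ : R.Fock) : Prop :=
  ∀ w : Word N, (w.map Prod.fst).Perm s → R.component w φ = 0

/-- The component of `L φ` at a word `w` depends only on the components of `φ` at the words with
the same momenta as `w`, in any order. -/
def IsLocal (L : Module.End ℂ R.Fock) : Prop :=
  ∀ (w : Word N) (φ : R.Fock), R.VanishesAt (w.map Prod.fst) φ → R.component w (L φ) = 0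

variable {R} in
theorem VanishesAt.annihilate {s : List ℝ} {k : ℝ} {φ : R.Fock} (h : R.VanishesAt (k :: s) φ)
    (j : Fin N) : R.VanishesAt s (R.annihilate j k φ) :=
  fun w hw => h ((k, j) :: w) (hw.cons k)

theorem isLocal_vertexTerm (n : ℕ) : ∀ M, R.IsLocal (R.vertexTerm n M) := by
  induction n with
  | zero =>
    intro M w φ h
    simp [vertexTerm, h w (List.Perm.refl _)]
  | succ n ih =>
    intro M w φ h
    simp only [vertexTerm, LinearMap.sum_apply, map_sum]
    refine Finset.sum_eq_zero fun α _ => Finset.sum_eq_zero fun β _ => ?_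
    refine R.component_create_eq_zero α fun k v hv => ih _ v _ ?_
    refine VanishesAt.annihilate (fun w' hw' => h w' (hw'.trans hv)) β

theorem isLocal_vertex (k₀ : ℝ) (α β : Fin N) : R.IsLocal (R.vertex k₀ α β) := by
  intro w
  induction w generalizing α with
  | nil =>
    intro φ h
    simp [component_nil_vertex, h [] (List.Perm.refl _)]
  | cons x w ih =>
    intro φ h
    obtain ⟨k, j⟩ := x
    simp only [component_cons, annihilate_vertex, map_legAct, ih _ _ (h.annihilate _)]
    simp [legAct]

variable {R} in
theorem IsLocal.sub {L L' : Module.End ℂ R.Fock} (h : R.IsLocal L) (h' : R.IsLocal L') :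
    R.IsLocal (L - L') := fun w φ hφ => by
  rw [LinearMap.sub_apply, map_sub, h w φ hφ, h' w φ hφ, sub_zero]

variable {R} in
theorem IsLocal.smul {L : Module.End ℂ R.Fock} (h : R.IsLocal L) (c : ℂ) :
    R.IsLocal (c • L) := fun w φ hφ => by
  rw [LinearMap.smul_apply, map_smul, h w φ hφ, smul_zero]

theorem isLocal_one : R.IsLocal 1 := fun w _ h => h w (List.Perm.refl _)

/-- By the symmetry of Fock vectors, the components with momenta in one order determine those with
the same momenta in any other order. -/
theorem component_perm_eq_zero {s s' : List ℝ} (hs : s.Perm s') :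
    ∀ φ : R.Fock, (∀ w : Word N, w.map Prod.fst = s → R.component w φ = 0) →
      ∀ w : Word N, w.map Prod.fst = s' → R.component w φ = 0 := by
  induction hs with
  | nil => exact fun φ h => h
  | cons k _ ih =>
    intro φ h w hw
    rw [List.map_eq_cons_iff] at hw
    obtain ⟨⟨k, j⟩, w, rfl, rfl, hw⟩ := hw
    exact ih (R.annihilate j k φ) (fun w' hw' => h ((k, j) :: w') (by simp [hw'])) w hw
  | swap p q l =>
    intro φ h w hw
    rw [List.map_eq_cons_iff] at hw
    obtain ⟨⟨p, i⟩, w, rfl, rfl, hw⟩ := hw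
    rw [List.map_eq_cons_iff] at hw
    obtain ⟨⟨q, j⟩, w, rfl, rfl, hw⟩ := hw
    rw [component_cons, component_cons, annihilate_annihilate, map_legAct]
    have h' (x y : Fin N) : R.component ((q, y) :: (p, x) :: w) φ = 0 := h _ (by simp [hw])
    simp only [component_cons] at h'
    simp [legAct, h']
  | trans _ _ ih₁ ih₂ => exact fun φ h => ih₂ φ (ih₁ φ h)

/-! ### The normally ordered expansion of a local operator -/

/-- `∑_β G[(k₁,α₁,β₁), …, (kₙ,αₙ,βₙ)] φ((k₁,β₁), …, (kₙ,βₙ))` for the word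
`[(k₁,α₁), …, (kₙ,αₙ)]`, as a linear form in `φ`. -/
def labelSum : Word N → (List (ℝ × Fin N × Fin N) → ℂ) → (R.Fock →ₗ[ℂ] ℂ)
  | [], G => G [] • R.component []
  | (k, α) :: w, G => ∑ β, labelSum w (fun l => G ((k, α, β) :: l)) ∘ₗ R.annihilate β k

theorem labelSum_add (w : Word N) : ∀ G G' : List (ℝ × Fin N × Fin N) → ℂ,
    R.labelSum w (fun l => G l + G' l) = R.labelSum w G + R.labelSum w G' := by
  induction w with
  | nil => intro G G'; simp [labelSum, add_smul]
  | cons x w ih =>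
    intro G G'
    simp only [labelSum, ih, LinearMap.add_comp, Finset.sum_add_distrib]

theorem labelSum_smul (w : Word N) (c : ℂ) : ∀ G : List (ℝ × Fin N × Fin N) → ℂ,
    R.labelSum w (fun l => c * G l) = c • R.labelSum w G := by
  induction w with
  | nil => intro G; simp [labelSum, mul_smul]
  | cons x w ih =>
    intro G
    simp only [labelSum, ih, LinearMap.smul_comp, Finset.smul_sum]

theorem labelSum_congr (w : Word N) : ∀ G G' : List (ℝ × Fin N × Fin N) → ℂ,
    (∀ l, l.map (fun x => (x.1, x.2.1)) = w → G l = G' l) → R.labelSum w G = R.labelSum w G' := by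
  induction w with
  | nil => intro G G' h; simp [labelSum, h [] rfl]
  | cons x w ih =>
    intro G G' h
    simp only [labelSum]
    refine Finset.sum_congr rfl fun β _ => ?_
    rw [ih _ _ fun l hl => h _ (by simp [hl])]

theorem exists_labelSum_eq_component (w : Word N) : ∀ w' : Word N,
    w'.map Prod.fst = w.map Prod.fst → ∃ G, R.labelSum w G = R.component w' := by
  induction w with
  | nil =>
    intro w' h
    obtain rfl : w' = [] := by simpa using h
    exact ⟨fun _ => 1, by simp [labelSum]⟩
  | cons x w ih =>
    intro w' h
    rw [List.map_cons, List.map_eq_cons_iff] at h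
    obtain ⟨k, α⟩ := x
    obtain ⟨⟨k, β⟩, w', rfl, rfl, h⟩ := h
    obtain ⟨G, hG⟩ := ih w' h
    -- the kernel is concentrated on the lists whose column labels are those of `w'`
    refine ⟨fun l => (if l.head?.map (fun y => y.2.2) = some β then 1 else 0) * G l.tail, ?_⟩
    simp only [labelSum, labelSum_smul, List.tail_cons, List.head?_cons, Option.map_some, hG,
      Option.some.injEq]
    have h0 (x : Fin N) : ((if x = β then (1 : ℂ) else 0) • R.component w') ∘ₗ R.annihilate x k =
        if x = β then R.component ((k, β) :: w') else 0 := by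
      split_ifs with hx
      · rw [hx, one_smul]
        rfl
      · rw [zero_smul, LinearMap.zero_comp]
    exact (Finset.sum_congr rfl fun x _ => h0 x).trans (Fintype.sum_ite_eq' β fun _ => _)

theorem finite_words_with_momenta (s : List ℝ) : Finite {w : Word N // w.map Prod.fst = s} := by
  have := (List.finite_length_eq (Fin N) s.length).to_subtype
  refine Finite.of_injective (β := {l : List (Fin N) | l.length = s.length})
    (fun w => ⟨w.1.map Prod.snd, by simpa using congrArg List.length w.2⟩) fun w w' h => ?_
  have h' : w.1.map Prod.snd = w'.1.map Prod.snd := congrArg Subtype.val h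
  exact Subtype.ext ((List.zip_of_prod w.2 rfl).trans (List.zip_of_prod w'.2 h'.symm).symm)

variable {R} in
/-- A local operator is a matrix multiplication in the labels: a linear form that vanishes on the
common kernel of finitely many linear forms is a linear combination of them. -/
theorem IsLocal.exists_labelSum {L : Module.End ℂ R.Fock} (hL : R.IsLocal L) :
    ∃ G, ∀ w : Word N, R.labelSum w G = R.component w ∘ₗ L := by
  have h (w : Word N) : ∃ G, R.labelSum w G = R.component w ∘ₗ L := by
    have := finite_words_with_momenta (N := N) (w.map Prod.fst)
    have hmem : R.component w ∘ₗ L ∈ Submodule.span ℂ (Set.range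
        fun w' : {w' : Word N // w'.map Prod.fst = w.map Prod.fst} => R.component w'.1) := by
      refine mem_span_of_iInf_ker_le_ker fun φ hφ => hL w φ fun w' hw' => ?_
      refine R.component_perm_eq_zero hw'.symm φ (fun v hv => ?_) w' rfl
      simp only [Submodule.mem_iInf] at hφ
      exact hφ ⟨v, hv⟩
    generalize R.component w ∘ₗ L = f at hmem
    induction hmem using Submodule.span_induction with
    | mem f hf =>
      obtain ⟨w', rfl⟩ := hf
      exact R.exists_labelSum_eq_component w w'.1 w'.2
    | zero => exact ⟨fun _ => 0 * 0, by rw [labelSum_smul, zero_smul]⟩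
    | add f g _ _ hf hg =>
      obtain ⟨F, rfl⟩ := hf
      obtain ⟨G, rfl⟩ := hg
      exact ⟨_, R.labelSum_add w F G⟩
    | smul c f _ hf =>
      obtain ⟨F, rfl⟩ := hf
      exact ⟨_, R.labelSum_smul w c F⟩
  choose G hG using h
  -- `labelSum w` evaluates the kernel only at lists from which `w` can be read off
  refine ⟨fun l => G (l.map fun x => (x.1, x.2.1)) l, fun w => ?_⟩
  rw [← hG w]
  refine R.labelSum_congr w _ _ fun l hl => ?_
  rw [hl]

/-- `∑_α ∫ dk a†_α(k) a_α(k)` counts the particles. -/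
theorem component_creation_annihilate (w : Word N) (Ψ : R.Fock) :
    R.component w (creation R.create fun k α => R.annihilate α k Ψ) =
      w.length * R.component w Ψ := by
  induction w generalizing Ψ with
  | nil => simp [component_nil_creation]
  | cons x w ih =>
    obtain ⟨k, j⟩ := x
    simp only [component_cons, annihilate_creation, ← annihilate_annihilate, map_add, ih]
    simp [add_mul]

/-- On the `n`-particle component, the normally ordered operator with `n` annihilators and the
kernel of a matrix multiplication is `n!` times this matrix multiplication. The statement for
families is what the induction on `n` needs. -/
theorem sum_component_vertexTerm (n : ℕ) : ∀ {ι : Type} (s : Finset ι)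
    (G : ι → List (ℝ × Fin N × Fin N) → ℂ) (φ : ι → R.Fock) (Ψ : R.Fock),
    (∀ v : Word N, v.length = n → ∑ x ∈ s, R.labelSum v (G x) (φ x) = R.component v Ψ) →
    ∀ v : Word N, v.length = n →
      ∑ x ∈ s, R.component v (R.vertexTerm n (fun l => G x l.reverse) (φ x)) =
        (n.factorial : ℂ) * R.component v Ψ := by
  induction n with
  | zero =>
    intro ι s G φ Ψ h v hv
    obtain rfl : v = [] := by simpa using hv
    simpa [vertexTerm, labelSum] using h [] rfl
  | succ n ih =>
    intro ι s G φ Ψ h w hw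
    have hΦ (k : ℝ) (α : Fin N) (v : Word N) (hv : v.length = n) :
        R.component v (∑ x ∈ s, ∑ β, R.vertexTerm n
          (fun l => G x ((k, α, β) :: l.reverse)) (R.annihilate β k (φ x))) =
        R.component v ((n.factorial : ℂ) • R.annihilate α k Ψ) := by
      have := ih (s ×ˢ Finset.univ) (fun (x : ι × Fin N) l => G x.1 ((k, α, x.2) :: l))
        (fun x => R.annihilate x.2 k (φ x.1)) (R.annihilate α k Ψ) (fun v hv => by
          rw [← component_cons, ← h ((k, α) :: v) (by simp [hv]), Finset.sum_product]
          simp [labelSum]) v hv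
      rw [Finset.sum_product] at this
      simpa [map_sum] using this
    calc _ = ∑ α, R.component w (R.create α fun k => ∑ x ∈ s, ∑ β, R.vertexTerm n
          (fun l => G x ((k, α, β) :: l.reverse)) (R.annihilate β k (φ x))) := by
          have hpi (α : Fin N) : (fun k => ∑ x ∈ s, ∑ β, R.vertexTerm n
              (fun l => G x ((k, α, β) :: l.reverse)) (R.annihilate β k (φ x))) =
              ∑ x ∈ s, ∑ β, fun k => R.vertexTerm n
              (fun l => G x ((k, α, β) :: l.reverse)) (R.annihilate β k (φ x)) := by
            funext k
            simp
          simp only [hpi, map_sum, vertexTerm, LinearMap.sum_apply, List.reverse_append,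
            List.reverse_singleton, List.singleton_append]
          exact Finset.sum_comm
      _ = ∑ α, R.component w (R.create α fun k => (n.factorial : ℂ) • R.annihilate α k Ψ) := by
          refine Finset.sum_congr rfl fun α _ => R.component_create_congr α fun k v hv => ?_
          refine hΦ k α v ?_
          have := hv.length_eq
          simp at this
          omega
      _ = (n.factorial : ℂ) * R.component w (creation R.create fun k α => R.annihilate α k Ψ) := by
          rw [creation_apply, map_sum, Finset.mul_sum]
          refine Finset.sum_congr rfl fun α _ => ?_
          rw [← smul_eq_mul, ← map_smul, ← map_smul]
          rfl
      _ = _ := by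
          rw [component_creation_annihilate, hw, Nat.factorial_succ]
          push_cast
          ring

theorem component_vertexTerm_eq_zero (n : ℕ) : ∀ (M) (φ : R.Fock) (w : Word N), w.length < n →
    R.component w (R.vertexTerm n M φ) = 0 := by
  induction n with
  | zero => intro M φ w h; simp at h
  | succ n ih =>
    intro M φ w h
    simp only [vertexTerm, LinearMap.sum_apply, map_sum]
    refine Finset.sum_eq_zero fun α _ => Finset.sum_eq_zero fun β _ => ?_
    refine R.component_create_eq_zero α fun k v hv => ih _ _ v ?_
    have := hv.length_eq
    simp at this
    omega

theorem vertexTerm_congr (n : ℕ) : ∀ M M' : List (ℝ × Fin N × Fin N) → ℂ,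
    (∀ l, l.length = n → M l = M' l) → R.vertexTerm n M = R.vertexTerm n M' := by
  induction n with
  | zero => intro M M' h; simp [vertexTerm, h [] rfl]
  | succ n ih =>
    intro M M' h
    simp only [vertexTerm]
    refine Finset.sum_congr rfl fun α _ => Finset.sum_congr rfl fun β _ => ?_
    have := fun k => ih (fun l => M (l ++ [(k, α, β)])) (fun l => M' (l ++ [(k, α, β)]))
      fun l hl => h _ (by simp [hl])
    simp only [this]

variable {R} in
/-- The term of order `n + 1` of a normally ordered expansion can be given any local value on the
words of length `n + 1`. -/
theorem IsLocal.exists_kernel {L : Module.End ℂ R.Fock} (hL : R.IsLocal L) (n : ℕ) :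
    ∃ M, ∀ (φ : R.Fock) (w : Word N), w.length = n + 1 →
      R.component w (((-1 : ℂ) ^ (n + 1) / (n.factorial : ℂ)) • R.vertexTerm (n + 1) M φ) =
        R.component w (L φ) := by
  have hc : ((-1 : ℂ) ^ (n + 1) / (n.factorial : ℂ)) * ((n + 1).factorial : ℂ) ≠ 0 := by
    have := Nat.factorial_ne_zero n
    have := Nat.factorial_ne_zero (n + 1)
    refine mul_ne_zero (div_ne_zero (by simp) ?_) ?_ <;> assumption_mod_cast
  set c := ((-1 : ℂ) ^ (n + 1) / (n.factorial : ℂ)) * ((n + 1).factorial : ℂ) with hcdef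
  obtain ⟨G, hG⟩ := (hL.smul c⁻¹).exists_labelSum
  refine ⟨fun l => G l.reverse, fun φ w hw => ?_⟩
  have := R.sum_component_vertexTerm (n + 1) {()} (fun _ => G) (fun _ => φ) ((c⁻¹ • L) φ)
    (fun v _ => by simp only [Finset.sum_singleton, hG]; rfl) w hw
  rw [Finset.sum_singleton] at this
  rw [map_smul, this, smul_eq_mul, ← mul_assoc, ← hcdef, LinearMap.smul_apply, map_smul,
    smul_eq_mul, mul_inv_cancel_left₀ hc]

/-- The remainders of the normally ordered expansion of a local operator: the next one is obtained
by subtracting a term that agrees with it on the words of length `n + 1`. -/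
def remainder (L : {L : Module.End ℂ R.Fock // R.IsLocal L}) :
    ℕ → {L : Module.End ℂ R.Fock // R.IsLocal L}
  | 0 => L
  | n + 1 => ⟨(remainder L n).1 - ((-1 : ℂ) ^ (n + 1) / (n.factorial : ℂ)) •
      R.vertexTerm (n + 1) ((remainder L n).2.exists_kernel n).choose,
      (remainder L n).2.sub ((R.isLocal_vertexTerm _ _).smul _)⟩

variable {R} in
/-- A local operator that annihilates the vacuum components has a normally ordered expansion. -/
theorem IsLocal.exists_expansion {L : Module.End ℂ R.Fock} (hL : R.IsLocal L)
    (h_nil : ∀ φ, R.component [] (L φ) = 0) :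
    ∃ K : List (ℝ × Fin N × Fin N) → ℂ, ∀ (φ : R.Fock) (w : Word N),
      HasSum (fun n : ℕ => (-1 : ℂ) ^ (n + 1) / (n.factorial : ℂ) *
        R.component w (R.vertexTerm (n + 1) K φ)) (R.component w (L φ)) := by
  set S := R.remainder ⟨L, hL⟩ with hS
  set M : ℕ → List (ℝ × Fin N × Fin N) → ℂ := fun n => ((S n).2.exists_kernel n).choose with hM
  have hMspec (n : ℕ) := ((S n).2.exists_kernel n).choose_spec
  refine ⟨fun l => M (l.length - 1) l, fun φ w => ?_⟩
  have hK (n : ℕ) : R.vertexTerm (n + 1) (fun l => M (l.length - 1) l) =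
      R.vertexTerm (n + 1) (M n) :=
    R.vertexTerm_congr _ _ _ fun l hl => by simp [hl]
  have hstep (n : ℕ) : R.component w ((S (n + 1)).1 φ) = R.component w ((S n).1 φ) -
      (-1 : ℂ) ^ (n + 1) / (n.factorial : ℂ) * R.component w (R.vertexTerm (n + 1) (M n) φ) := by
    rw [← smul_eq_mul, ← map_smul, ← map_sub]
    rfl
  have hsum (n : ℕ) : ∑ m ∈ Finset.range n, (-1 : ℂ) ^ (m + 1) / (m.factorial : ℂ) *
      R.component w (R.vertexTerm (m + 1) (M m) φ) =
        R.component w (L φ) - R.component w ((S n).1 φ) := by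
    induction n with
    | zero => simp [hS, remainder]
    | succ n ih => rw [Finset.sum_range_succ, ih, hstep]; ring
  -- terms of order above `w.length` vanish at `w`, and the one of that order cancels the remainder
  have hrem : R.component w ((S w.length).1 φ) = 0 := by
    rcases hw : w.length with _ | n
    · obtain rfl : w = [] := by simpa using hw
      exact h_nil φ
    · rw [hstep, ← hMspec n φ w hw, map_smul, smul_eq_mul, sub_self]
  have := hasSum_sum_of_ne_finset_zero (s := Finset.range w.length)
    (L := SummationFilter.unconditional ℕ)
    (f := fun n : ℕ => (-1 : ℂ) ^ (n + 1) / (n.factorial : ℂ) *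
      R.component w (R.vertexTerm (n + 1) (M n) φ)) fun n hn => by
        rw [R.component_vertexTerm_eq_zero (n + 1) _ _ w (by simp at hn; omega), mul_zero]
  rw [hsum, hrem, sub_zero] at this
  simpa only [hK] using this

theorem isVertexOperator_vertex : R.IsVertexOperator R.vertex := by
  have h (k₀ : ℝ) (α β : Fin N) := ((R.isLocal_vertex k₀ α β).sub
    (R.isLocal_one.smul (if α = β then 1 else 0))).exists_expansion fun φ => by
      rw [LinearMap.sub_apply, map_sub, component_nil_vertex]
      split_ifs <;> simp
  choose K hK using h
  refine ⟨K, fun k₀ α β φ w => ?_⟩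
  have := hK k₀ α β φ w
  rw [LinearMap.sub_apply, map_sub, LinearMap.smul_apply, map_smul, smul_eq_mul, ite_mul,
    one_mul, zero_mul] at this
  exact this

/-- Every normally ordered term with a creator has no vacuum component. -/
theorem IsVertexOperator.component_nil
    {T : ℝ → Matrix (Fin N) (Fin N) (Module.End ℂ R.Fock)} (hT : R.IsVertexOperator T)
    (k₀ : ℝ) (α β : Fin N) (φ : R.Fock) :
    R.component [] (T k₀ α β φ) = if α = β then R.component [] φ else 0 := by
  obtain ⟨K, hK⟩ := hT
  have h := hK k₀ α β φ []
  have h0 (n : ℕ) : (R.vertexTerm (n + 1) (K k₀ α β) φ).1 [] = 0 :=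
    R.component_vertexTerm_eq_zero (n + 1) _ _ [] (by simp)
  simp only [h0, mul_zero] at h
  exact sub_eq_zero.mp (h.unique hasSum_zero)

/-! ### Exchange relations as identities between maps on `V`, `V ⊗ ℂ^N` and `V ⊗ ℂ^N ⊗ ℂ^N` -/

/-- A matrix of operators on `V` acting on columns with entries in `V`. -/
def opAct {ι : Type*} [Fintype ι] [DecidableEq ι] :
    Matrix ι ι (Module.End ℂ V) ≃+* Module.End ℂ (ι → V) :=
  (endVecRingEquivMatrixEnd ι ℂ V).symm

/-- A numerical matrix acting on columns with entries in `V`. -/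
def numAct {ι : Type*} [Fintype ι] [DecidableEq ι] (M : Matrix ι ι ℂ) : Module.End ℂ (ι → V) :=
  opAct (scalarOp V M)

/-- The column `a(k)`, as a map `V → V ⊗ ℂ^N`. -/
def annCol (a : Fin N → ℝ → Module.End ℂ V) (k : ℝ) : V →ₗ[ℂ] (Fin N → V) :=
  LinearMap.pi fun i => a i k

/-- `a₁(k)` applied to a column in the second leg. -/
def ann₁ (a : Fin N → ℝ → Module.End ℂ V) (k : ℝ) : (Fin N → V) →ₗ[ℂ] (Fin N × Fin N → V) :=
  LinearMap.pi fun p => a p.1 k ∘ₗ LinearMap.proj p.2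

/-- `a₂(k)` applied to a column in the first leg. -/
def ann₂ (a : Fin N → ℝ → Module.End ℂ V) (k : ℝ) : (Fin N → V) →ₗ[ℂ] (Fin N × Fin N → V) :=
  LinearMap.pi fun p => a p.2 k ∘ₗ LinearMap.proj p.1

/-- `∫ dk a†₁(k) Φ(k)`, which contracts the first leg. -/
def cre₁ (adag : Fin N → (ℝ → V) →ₗ[ℂ] V) (Φ : ℝ → Fin N × Fin N → V) : Fin N → V :=
  fun j => creation adag fun k i => Φ k (i, j)

/-- `∫ dk a†₂(k) Φ(k)`, which contracts the second leg. -/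
def cre₂ (adag : Fin N → (ℝ → V) →ₗ[ℂ] V) (Φ : ℝ → Fin N × Fin N → V) : Fin N → V :=
  fun i => creation adag fun k j => Φ k (i, j)

/-- The exchange of the two legs of a tensor. -/
def swapLegs : (Fin N × Fin N → V) →ₗ[ℂ] (Fin N × Fin N → V) :=
  LinearMap.funLeft ℂ V Prod.swap

theorem opAct_apply {ι : Type*} [Fintype ι] [DecidableEq ι] (M : Matrix ι ι (Module.End ℂ V))
    (v : ι → V) (i : ι) : opAct M v i = ∑ j, M i j (v j) := rfl

theorem opAct_mul {ι : Type*} [Fintype ι] [DecidableEq ι] (M M' : Matrix ι ι (Module.End ℂ V))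
    (v : ι → V) : opAct (M * M') v = opAct M (opAct M' v) := by
  rw [map_mul]
  rfl

theorem opAct_single {ι : Type*} [Fintype ι] [DecidableEq ι] (M : Matrix ι ι (Module.End ℂ V))
    (i j : ι) (x : V) : opAct M (Pi.single j x) i = M i j x := by
  rw [opAct_apply, Finset.sum_eq_single j (fun b _ hb => by simp [hb]) (by simp)]
  simp

theorem numAct_apply {ι : Type*} [Fintype ι] [DecidableEq ι] (M : Matrix ι ι ℂ)
    (v : ι → V) (i : ι) : numAct M v i = ∑ j, M i j • v j := rfl

theorem numAct_eq_legAct (M : Matrix (Fin N × Fin N) (Fin N × Fin N) ℂ)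
    (v : Fin N × Fin N → V) (i j : Fin N) :
    numAct M v (i, j) = legAct M (fun a b => v (a, b)) i j := by
  rw [numAct_apply, legAct_eq_sum]

theorem opAct_leg1 (X : Matrix (Fin N) (Fin N) (Module.End ℂ V)) (v : Fin N × Fin N → V)
    (i j : Fin N) : opAct (leg1 X) v (i, j) = ∑ s, X i s (v (s, j)) := by
  rw [opAct_apply, Fintype.sum_prod_type]
  refine Finset.sum_congr rfl fun s _ => ?_
  rw [Finset.sum_eq_single j (fun b _ hb => by simp [leg1, hb.symm]) (by simp)]
  simp [leg1]

theorem opAct_leg2 (X : Matrix (Fin N) (Fin N) (Module.End ℂ V)) (v : Fin N × Fin N → V)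
    (i j : Fin N) : opAct (leg2 X) v (i, j) = ∑ s, X j s (v (i, s)) := by
  rw [opAct_apply, Fintype.sum_prod_type_right]
  refine Finset.sum_congr rfl fun s _ => ?_
  rw [Finset.sum_eq_single i (fun b _ hb => by simp [leg2, hb.symm]) (by simp)]
  simp [leg2]

theorem numAct_R12_R21 (p q : ℝ) (v : Fin N × Fin N → V) :
    numAct (R.R12 p q) (numAct (R.R21 q p) v) = v := by
  rw [numAct, numAct, ← opAct_mul, scalarOp, scalarOp, ← Matrix.map_mul, R12_mul_R21,
    Matrix.map_one _ (map_zero _) (map_one _), map_one]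
  rfl

theorem numAct_R21_R12 (p q : ℝ) (v : Fin N × Fin N → V) :
    numAct (R.R21 p q) (numAct (R.R12 q p) v) = v := by
  rw [numAct, numAct, ← opAct_mul, scalarOp, scalarOp, ← Matrix.map_mul, R21_mul_R12,
    Matrix.map_one _ (map_zero _) (map_one _), map_one]
  rfl

theorem swapLegs_apply (v : Fin N × Fin N → V) (i j : Fin N) : swapLegs v (i, j) = v (j, i) := rfl

theorem swapLegs_swapLegs (v : Fin N × Fin N → V) : swapLegs (swapLegs v) = v := rfl

theorem swapLegs_ann₁ (a : Fin N → ℝ → Module.End ℂ V) (k : ℝ) (y : Fin N → V) :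
    swapLegs (ann₁ a k y) = ann₂ a k y := rfl

theorem swapLegs_ann₂ (a : Fin N → ℝ → Module.End ℂ V) (k : ℝ) (y : Fin N → V) :
    swapLegs (ann₂ a k y) = ann₁ a k y := rfl

theorem cre₁_eq_cre₂_swapLegs (adag : Fin N → (ℝ → V) →ₗ[ℂ] V) (Φ : ℝ → Fin N × Fin N → V) :
    cre₁ adag Φ = cre₂ adag fun k => swapLegs (Φ k) := rfl

theorem swapLegs_R12 (p q : ℝ) (v : Fin N × Fin N → V) :
    swapLegs (numAct (R.R12 p q) v) = numAct (R.R21 p q) (swapLegs v) := by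
  funext ⟨i, j⟩
  rw [swapLegs_apply, numAct_eq_legAct, numAct_eq_legAct, legAct_R21]
  rfl

theorem swapLegs_R21 (p q : ℝ) (v : Fin N × Fin N → V) :
    swapLegs (numAct (R.R21 p q) v) = numAct (R.R12 p q) (swapLegs v) := by
  rw [← swapLegs_swapLegs v, ← swapLegs_R12, swapLegs_swapLegs, swapLegs_swapLegs]

theorem swapLegs_leg1 (X : Matrix (Fin N) (Fin N) (Module.End ℂ V)) (v : Fin N × Fin N → V) :
    swapLegs (opAct (leg1 X) v) = opAct (leg2 X) (swapLegs v) := by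
  funext ⟨i, j⟩
  rw [swapLegs_apply, opAct_leg1, opAct_leg2]
  rfl

theorem swapLegs_leg2 (X : Matrix (Fin N) (Fin N) (Module.End ℂ V)) (v : Fin N × Fin N → V) :
    swapLegs (opAct (leg2 X) v) = opAct (leg1 X) (swapLegs v) := by
  funext ⟨i, j⟩
  rw [swapLegs_apply, opAct_leg1, opAct_leg2]
  rfl

theorem cre₂_add (adag : Fin N → (ℝ → V) →ₗ[ℂ] V) (Φ Ψ : ℝ → Fin N × Fin N → V) :
    cre₂ adag (fun k => Φ k + Ψ k) = cre₂ adag Φ + cre₂ adag Ψ :=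
  funext fun _ => creation_add adag _ _

theorem cre₂_smul (adag : Fin N → (ℝ → V) →ₗ[ℂ] V) (c : ℂ) (Φ : ℝ → Fin N × Fin N → V) :
    cre₂ adag (fun k => c • Φ k) = c • cre₂ adag Φ :=
  funext fun _ => map_smul (creation adag) c _

/-- Pointwise sums of columns; `creation_add` is the version with the column index applied. -/
theorem creation_add' (adag : Fin N → (ℝ → V) →ₗ[ℂ] V) (Φ Ψ : ℝ → Fin N → V) :
    creation adag (fun k => Φ k + Ψ k) = creation adag Φ + creation adag Ψ :=
  map_add (creation adag) Φ Ψ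

theorem creation_smul (adag : Fin N → (ℝ → V) →ₗ[ℂ] V) (c : ℂ) (Φ : ℝ → Fin N → V) :
    creation adag (fun k => c • Φ k) = c • creation adag Φ :=
  map_smul (creation adag) c Φ

/-! ### From maps on columns to matrix entries -/

theorem adag_zero (adag : Fin N → (ℝ → V) →ₗ[ℂ] V) (j : Fin N) :
    adag j (fun _ => 0) = 0 := map_zero (adag j)

theorem creation_single (adag : Fin N → (ℝ → V) →ₗ[ℂ] V) (j : Fin N) (Φ : ℝ → V) :
    creation adag (fun k => Pi.single j (Φ k)) = adag j Φ := by
  rw [creation_apply, Finset.sum_eq_single j (fun b _ hb => by simp [hb, adag_zero]) (by simp)]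
  simp

theorem cre₂_single (adag : Fin N → (ℝ → V) →ₗ[ℂ] V) (i j : Fin N) (Φ : ℝ → V) :
    cre₂ adag (fun k => Pi.single (i, j) (Φ k)) = Pi.single i (adag j Φ) := by
  funext s
  rw [cre₂]
  rcases eq_or_ne s i with rfl | hs
  · rw [Pi.single_eq_same, ← creation_single]
    congr 1
    funext k t
    simp [Pi.single_apply]
  · rw [Pi.single_eq_of_ne hs]
    refine (congrArg (creation adag) ?_).trans (map_zero (creation adag))
    funext k t
    simp [hs]

section Entries

variable {a : Fin N → ℝ → Module.End ℂ V} {adag : Fin N → (ℝ → V) →ₗ[ℂ] V}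
  {b : ℝ → Matrix (Fin N) (Fin N) (Module.End ℂ V)}

/-! Each relation in matrix entries is the corresponding identity between maps on columns, evaluated
at columns with a single nonzero entry. -/

theorem mul_eq_of_ann₁_annCol {k₁ k₂ : ℝ}
    (h : ∀ x, ann₁ a k₁ (annCol a k₂ x) = numAct (R.R21 k₂ k₁) (ann₂ a k₂ (annCol a k₁ x)))
    (i j : Fin N) :
    a i k₁ * a j k₂ = ∑ i', ∑ j', R.R21 k₂ k₁ (i, j) (i', j') • (a j' k₂ * a i' k₁) := by
  refine LinearMap.ext fun x => ?_
  have := congrFun (h x) (i, j)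
  rw [numAct_eq_legAct] at this
  simp only [LinearMap.sum_apply]
  exact this

theorem adag_adag_of_creation_cre₂
    (h : ∀ Φ : ℝ → ℝ → Fin N × Fin N → V, creation adag (fun k₁ => cre₂ adag (Φ k₁)) =
      creation adag (fun k₂ => cre₁ adag fun k₁ => numAct (R.R21 k₂ k₁) (Φ k₁ k₂)))
    (i j : Fin N) (Φ : ℝ → ℝ → V) :
    adag i (fun k₁ => adag j (fun k₂ => Φ k₁ k₂)) =
      ∑ i', ∑ j', adag j' (fun k₂ => adag i' (fun k₁ =>
        R.R21 k₂ k₁ (i', j') (i, j) • Φ k₁ k₂)) := by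
  have := h fun k₁ k₂ => Pi.single (i, j) (Φ k₁ k₂)
  simp only [cre₂_single, creation_single] at this
  rw [this, creation_apply, Finset.sum_comm]
  refine Finset.sum_congr rfl fun j' _ => ?_
  rw [← map_sum]
  congr 1
  funext k₂
  simp only [cre₁, creation_apply, Finset.sum_apply, numAct]
  simp only [opAct_single]
  rfl

theorem a_adag_of_annCol_creation {k₁ : ℝ} {E : (ℝ → Fin N → V) → Fin N → V}
    (h : ∀ Φ : ℝ → Fin N → V, annCol a k₁ (creation adag Φ) =
      cre₂ adag (fun k₂ => numAct (R.R12 k₁ k₂) (ann₁ a k₁ (Φ k₂))) + E Φ)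
    (i j : Fin N) (Φ : ℝ → V) :
    a i k₁ (adag j Φ) =
      (∑ i', ∑ j', adag j' (fun k₂ => R.R12 k₁ k₂ (i, j') (i', j) • a i' k₁ (Φ k₂)))
        + E (fun k => Pi.single j (Φ k)) i := by
  have := congrFun (h fun k => Pi.single j (Φ k)) i
  rw [creation_single] at this
  rw [Pi.add_apply, cre₂, creation_apply] at this
  refine this.trans ?_
  rw [Finset.sum_comm]
  congr 1
  refine Finset.sum_congr rfl fun j' _ => ?_
  rw [← map_sum]
  congr 1
  funext k₂
  rw [numAct_eq_legAct, legAct, Finset.sum_apply]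
  refine Finset.sum_congr rfl fun i' _ => ?_
  rw [Finset.sum_eq_single j (fun b _ hb => by simp [ann₁, hb]) (by simp)]
  simp [ann₁]

theorem a_b_of_ann₁_opAct {k₁ k₂ : ℝ}
    (h : ∀ y, ann₁ a k₁ (opAct (b k₂) y) = numAct (R.R21 k₂ k₁)
      (opAct (leg2 (b k₂)) (numAct (R.R12 k₁ (-k₂)) (ann₁ a k₁ y)))) (i j j' : Fin N) :
    a i k₁ * b k₂ j j' =
      ∑ i', (scalarOp V (R.R21 k₂ k₁) * leg2 (b k₂) * scalarOp V (R.R12 k₁ (-k₂)))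
        (i, j) (i', j') * a i' k₁ := by
  refine LinearMap.ext fun x => ?_
  have := congrFun (h (Pi.single j' x)) (i, j)
  rw [numAct, numAct, ← opAct_mul, ← opAct_mul] at this
  simp only [ann₁, LinearMap.pi_apply, LinearMap.comp_apply, LinearMap.proj_apply,
    opAct_single] at this
  rw [Module.End.mul_apply, this, opAct_apply, Fintype.sum_prod_type, LinearMap.sum_apply]
  refine Finset.sum_congr rfl fun i' _ => ?_
  rw [Finset.sum_eq_single j' (fun b _ hb => by simp [hb]) (by simp)]
  simp

theorem b_adag_of_opAct_cre₂ {k₁ : ℝ}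
    (h : ∀ Φ : ℝ → Fin N × Fin N → V, opAct (b k₁) (cre₂ adag Φ) =
      cre₂ adag (fun k₂ => numAct (R.R12 k₁ k₂)
        (opAct (leg1 (b k₁)) (numAct (R.R21 k₂ (-k₁)) (Φ k₂))))) (i i' j : Fin N) (Φ : ℝ → V) :
    b k₁ i i' (adag j Φ) =
      ∑ j', adag j' (fun k₂ =>
        (scalarOp V (R.R12 k₁ k₂) * leg1 (b k₁) * scalarOp V (R.R21 k₂ (-k₁)))
          (i, j') (i', j) (Φ k₂)) := by
  have := congrFun (h fun k => Pi.single (i', j) (Φ k)) i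
  simp only [cre₂_single, opAct_single] at this
  rw [this, cre₂, creation_apply]
  simp only [numAct, ← opAct_mul, ← mul_assoc, opAct_single]

end Entries

/-! ### The ZF relations in terms of columns -/

theorem ann₁_annCol (k₁ k₂ : ℝ) (φ : R.Fock) :
    ann₁ R.annihilate k₁ (annCol R.annihilate k₂ φ) =
      numAct (R.R21 k₂ k₁) (ann₂ R.annihilate k₂ (annCol R.annihilate k₁ φ)) := by
  funext ⟨i, j⟩
  rw [numAct_eq_legAct, legAct_R21]
  exact R.annihilate_annihilate k₂ k₁ j i φ

theorem annCol_creation (k : ℝ) (Φ : ℝ → Fin N → R.Fock) :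
    annCol R.annihilate k (creation R.create Φ) =
      cre₂ R.create (fun k₂ => numAct (R.R12 k k₂) (ann₁ R.annihilate k (Φ k₂))) + Φ k := by
  funext i
  simp only [Pi.add_apply, cre₂, numAct_eq_legAct]
  exact R.annihilate_creation k i Φ

theorem creation_cre₂ (Φ : ℝ → ℝ → Fin N × Fin N → R.Fock) :
    creation R.create (fun k₁ => cre₂ R.create (Φ k₁)) =
      creation R.create (fun k₂ => cre₁ R.create fun k₁ => numAct (R.R21 k₂ k₁) (Φ k₁ k₂)) := by
  unfold cre₁ cre₂
  simp only [numAct_eq_legAct]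
  exact R.creation_creation fun k₁ k₂ i j => Φ k₁ k₂ (i, j)

theorem zfRelations_fock : R.ZFRelations R.annihilate R.create where
  a_a k₁ k₂ := R.mul_eq_of_ann₁_annCol (R.ann₁_annCol k₁ k₂)
  adag_adag := R.adag_adag_of_creation_cre₂ R.creation_cre₂
  a_adag k₁ i j Φ := R.annihilate_create k₁ i j Φ

/-! ### The boundary generators -/

/-- The exchange relations of `b` with itself and with the generators `a`, `a†` of the ZF algebra:
they have the form of the relations of `b` with `ã`, `ã†` in the boundary algebra. -/
structure IsReflectionOp (b : ℝ → Matrix (Fin N) (Fin N) (Module.End ℂ R.Fock)) : Prop where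
  ann₁_b : ∀ (k₁ k₂ : ℝ) (y : Fin N → R.Fock), ann₁ R.annihilate k₁ (opAct (b k₂) y) =
    numAct (R.R21 k₂ k₁) (opAct (leg2 (b k₂)) (numAct (R.R12 k₁ (-k₂)) (ann₁ R.annihilate k₁ y)))
  b_cre₂ : ∀ (k₁ : ℝ) (Φ : ℝ → Fin N × Fin N → R.Fock), opAct (b k₁) (cre₂ R.create Φ) =
    cre₂ R.create (fun k₂ => numAct (R.R12 k₁ k₂)
      (opAct (leg1 (b k₁)) (numAct (R.R21 k₂ (-k₁)) (Φ k₂))))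
  b_b : ∀ k₁ k₂ : ℝ,
    scalarOp R.Fock (R.R12 k₁ k₂) * leg1 (b k₁) * scalarOp R.Fock (R.R21 k₂ (-k₁)) *
      leg2 (b k₂) = leg2 (b k₂) * scalarOp R.Fock (R.R12 k₁ (-k₂)) * leg1 (b k₁) *
        scalarOp R.Fock (R.R21 (-k₂) (-k₁))
  b_inv : ∀ k : ℝ, b k * b (-k) = 1

section Boundary

variable {b : ℝ → Matrix (Fin N) (Fin N) (Module.End ℂ R.Fock)}

theorem annCol_boundaryA (k : ℝ) (φ : R.Fock) : annCol (R.boundaryA b) k φ =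
    (1 / 2 : ℂ) • (annCol R.annihilate k φ + opAct (b k) (annCol R.annihilate (-k) φ)) := by
  funext i
  simp [annCol, boundaryA, opAct_apply]

theorem ann₁_boundaryA (k : ℝ) (y : Fin N → R.Fock) : ann₁ (R.boundaryA b) k y =
    (1 / 2 : ℂ) • (ann₁ R.annihilate k y +
      opAct (leg1 (b k)) (ann₁ R.annihilate (-k) y)) := by
  funext ⟨i, j⟩
  rw [Pi.smul_apply, Pi.add_apply, opAct_leg1]
  simp [ann₁, boundaryA]

theorem ann₂_boundaryA (k : ℝ) (y : Fin N → R.Fock) : ann₂ (R.boundaryA b) k y =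
    (1 / 2 : ℂ) • (ann₂ R.annihilate k y +
      opAct (leg2 (b k)) (ann₂ R.annihilate (-k) y)) := by
  rw [← swapLegs_ann₁, ann₁_boundaryA, map_smul, map_add, swapLegs_leg1]
  rfl

theorem creation_boundaryAdag (Φ : ℝ → Fin N → R.Fock) : creation (R.boundaryAdag b) Φ =
    (1 / 2 : ℂ) • (creation R.create Φ +
      creation R.create (fun k => opAct (b k) (Φ (-k)))) := by
  have h (f : Fin N → ℝ → R.Fock) (j : Fin N) :
      R.create j (fun k => ∑ i, f i k) = ∑ i, R.create j (f i) := by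
    rw [← map_sum]
    congr 1
    funext k
    simp
  simp only [creation_apply, boundaryAdag, LinearMap.smul_apply, LinearMap.add_apply,
    LinearMap.sum_apply, opAct_apply, h, ← Finset.smul_sum, Finset.sum_add_distrib]
  congr 2
  exact Finset.sum_comm

theorem cre₂_boundaryAdag (Φ : ℝ → Fin N × Fin N → R.Fock) : cre₂ (R.boundaryAdag b) Φ =
    (1 / 2 : ℂ) • (cre₂ R.create Φ +
      cre₂ R.create (fun k => opAct (leg2 (b k)) (Φ (-k)))) := by
  funext i
  simp only [cre₂, creation_boundaryAdag, Pi.smul_apply, Pi.add_apply, opAct_leg2]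
  rfl

theorem cre₁_boundaryAdag (Φ : ℝ → Fin N × Fin N → R.Fock) : cre₁ (R.boundaryAdag b) Φ =
    (1 / 2 : ℂ) • (cre₁ R.create Φ +
      cre₁ R.create (fun k => opAct (leg1 (b k)) (Φ (-k)))) := by
  simp only [cre₁_eq_cre₂_swapLegs, cre₂_boundaryAdag, swapLegs_leg1]

end Boundary

namespace IsReflectionOp

variable {R} {b : ℝ → Matrix (Fin N) (Fin N) (Module.End ℂ R.Fock)}

theorem ann₂_b (hb : R.IsReflectionOp b) (k₁ k₂ : ℝ) (y : Fin N → R.Fock) :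
    ann₂ R.annihilate k₁ (opAct (b k₂) y) =
      numAct (R.R12 k₂ k₁) (opAct (leg1 (b k₂))
        (numAct (R.R21 k₁ (-k₂)) (ann₂ R.annihilate k₁ y))) := by
  rw [← swapLegs_ann₁, hb.ann₁_b, swapLegs_R21, swapLegs_leg2, swapLegs_R12, swapLegs_ann₁]

theorem b_cre₁ (hb : R.IsReflectionOp b) (k₁ : ℝ) (Φ : ℝ → Fin N × Fin N → R.Fock) :
    opAct (b k₁) (cre₁ R.create Φ) = cre₁ R.create (fun k₂ => numAct (R.R21 k₁ k₂)
      (opAct (leg2 (b k₁)) (numAct (R.R12 k₂ (-k₁)) (Φ k₂)))) := by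
  simp only [cre₁_eq_cre₂_swapLegs, hb.b_cre₂, swapLegs_R21, swapLegs_leg2, swapLegs_R12]

theorem reflection (hb : R.IsReflectionOp b) (k₁ k₂ : ℝ) (v : Fin N × Fin N → R.Fock) :
    numAct (R.R12 k₁ k₂) (opAct (leg1 (b k₁)) (numAct (R.R21 k₂ (-k₁))
      (opAct (leg2 (b k₂)) v))) =
    opAct (leg2 (b k₂)) (numAct (R.R12 k₁ (-k₂)) (opAct (leg1 (b k₁))
      (numAct (R.R21 (-k₂) (-k₁)) v))) := by
  have := congrArg (fun X => opAct X v) (hb.b_b k₁ k₂)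
  simpa only [opAct_mul, numAct] using this

/-- The reflection equation with `R₁₂(k₁, k₂)` moved to the right-hand side. -/
theorem leg1_R21_leg2 (hb : R.IsReflectionOp b) (k₁ k₂ : ℝ) (v : Fin N × Fin N → R.Fock) :
    opAct (leg1 (b k₁)) (numAct (R.R21 k₂ (-k₁)) (opAct (leg2 (b k₂)) v)) =
    numAct (R.R21 k₂ k₁) (opAct (leg2 (b k₂)) (numAct (R.R12 k₁ (-k₂)) (opAct (leg1 (b k₁))
      (numAct (R.R21 (-k₂) (-k₁)) v)))) := by
  rw [← hb.reflection, numAct_R21_R12]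

theorem b_b_neg (hb : R.IsReflectionOp b) (k : ℝ) (y : Fin N → R.Fock) :
    opAct (b k) (opAct (b (-k)) y) = y := by
  rw [← opAct_mul, hb.b_inv, map_one]
  rfl

/-- `ã₁(k₁) ã₂(k₂) = R₂₁(k₂, k₁) ã₂(k₂) ã₁(k₁)`. The two mixed terms are interchanged. -/
theorem ann₁_annCol_boundaryA (hb : R.IsReflectionOp b) (k₁ k₂ : ℝ) (φ : R.Fock) :
    ann₁ (R.boundaryA b) k₁ (annCol (R.boundaryA b) k₂ φ) =
      numAct (R.R21 k₂ k₁) (ann₂ (R.boundaryA b) k₂ (annCol (R.boundaryA b) k₁ φ)) := by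
  simp only [ann₁_boundaryA, ann₂_boundaryA, annCol_boundaryA, map_smul, map_add, ← smul_add,
    hb.ann₁_b, hb.ann₂_b, ann₁_annCol, numAct_R21_R12, numAct_R12_R21, hb.leg1_R21_leg2]
  rw [add_add_add_comm]

/-- `ã₁(k₁) ã†₂(k₂) = ã†₂(k₂) R₁₂(k₁, k₂) ã₁(k₁) + ½ δ₁₂ δ(k₁ - k₂) + ½ b₁₂(k₁) δ(k₁ + k₂)`.
Each of the two contact terms arises twice with the factor `¼`. -/
theorem annCol_creation_boundary (hb : R.IsReflectionOp b) (k : ℝ) (Φ : ℝ → Fin N → R.Fock) :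
    annCol (R.boundaryA b) k (creation (R.boundaryAdag b) Φ) =
      cre₂ (R.boundaryAdag b)
        (fun k₂ => numAct (R.R12 k k₂) (ann₁ (R.boundaryA b) k (Φ k₂))) +
      ((1 / 2 : ℂ) • Φ k + (1 / 2 : ℂ) • opAct (b k) (Φ (-k))) := by
  simp only [annCol_boundaryA, creation_boundaryAdag, map_smul, map_add, annCol_creation,
    cre₂_boundaryAdag, ann₁_boundaryA, hb.b_cre₂, hb.ann₁_b, hb.reflection, hb.b_b_neg,
    numAct_R12_R21, numAct_R21_R12, cre₂_add, cre₂_smul, neg_neg]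
  module

theorem ann₁_opAct_boundaryA (hb : R.IsReflectionOp b) (k₁ k₂ : ℝ) (y : Fin N → R.Fock) :
    ann₁ (R.boundaryA b) k₁ (opAct (b k₂) y) = numAct (R.R21 k₂ k₁)
      (opAct (leg2 (b k₂)) (numAct (R.R12 k₁ (-k₂)) (ann₁ (R.boundaryA b) k₁ y))) := by
  simp only [ann₁_boundaryA, map_smul, map_add, hb.ann₁_b, hb.leg1_R21_leg2, numAct_R21_R12]

theorem opAct_cre₂_boundaryAdag (hb : R.IsReflectionOp b) (k₁ : ℝ)
    (Φ : ℝ → Fin N × Fin N → R.Fock) :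
    opAct (b k₁) (cre₂ (R.boundaryAdag b) Φ) =
      cre₂ (R.boundaryAdag b) (fun k₂ => numAct (R.R12 k₁ k₂)
        (opAct (leg1 (b k₁)) (numAct (R.R21 k₂ (-k₁)) (Φ k₂)))) := by
  simp only [cre₂_boundaryAdag, map_smul, map_add, hb.b_cre₂, hb.reflection]

theorem creation_cre₂_boundaryAdag (hb : R.IsReflectionOp b)
    (Φ : ℝ → ℝ → Fin N × Fin N → R.Fock) :
    creation (R.boundaryAdag b) (fun k₁ => cre₂ (R.boundaryAdag b) (Φ k₁)) =
      creation (R.boundaryAdag b)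
        (fun k₂ => cre₁ (R.boundaryAdag b) fun k₁ => numAct (R.R21 k₂ k₁) (Φ k₁ k₂)) := by
  simp only [creation_boundaryAdag, cre₂_boundaryAdag, cre₁_boundaryAdag,
    creation_add', creation_smul, hb.b_cre₂, hb.b_cre₁, creation_cre₂, hb.leg1_R21_leg2,
    numAct_R12_R21, numAct_R21_R12]
  module

theorem reflectionInvariant (hb : R.IsReflectionOp b) :
    RMatrix.ReflectionInvariant (R.boundaryA b) (R.boundaryAdag b) b where
  a_eq i k := by
    refine LinearMap.ext fun φ => ?_
    have h : annCol (R.boundaryA b) k φ = opAct (b k) (annCol (R.boundaryA b) (-k) φ) := by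
      rw [annCol_boundaryA, annCol_boundaryA, map_smul, map_add, hb.b_b_neg, neg_neg, add_comm]
    rw [LinearMap.sum_apply]
    exact congrFun h i
  adag_eq i Φ := by
    have h (Φ : ℝ → Fin N → R.Fock) : creation (R.boundaryAdag b) Φ =
        creation (R.boundaryAdag b) (fun k => opAct (b k) (Φ (-k))) := by
      simp only [creation_boundaryAdag, hb.b_b_neg, neg_neg, add_comm]
    have := h fun k => Pi.single i (Φ k)
    rw [creation_single, creation_apply] at this
    simpa only [opAct_single] using this

theorem boundaryRelations (hb : R.IsReflectionOp b) :
    R.BoundaryRelations (R.boundaryA b) (R.boundaryAdag b) b where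
  a_a k₁ k₂ := R.mul_eq_of_ann₁_annCol (hb.ann₁_annCol_boundaryA k₁ k₂)
  adag_adag := R.adag_adag_of_creation_cre₂ hb.creation_cre₂_boundaryAdag
  a_adag k₁ i j Φ := by
    rw [R.a_adag_of_annCol_creation (hb.annCol_creation_boundary k₁) i j Φ, add_assoc]
    simp only [Pi.add_apply, Pi.smul_apply, opAct_single, Pi.single_apply]
  a_b k₁ k₂ := R.a_b_of_ann₁_opAct (hb.ann₁_opAct_boundaryA k₁ k₂)
  b_adag k₁ := R.b_adag_of_opAct_cre₂ (hb.opAct_cre₂_boundaryAdag k₁)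
  b_b := hb.b_b
  b_inv := hb.b_inv

end IsReflectionOp

/-! ### The vertex operator in terms of columns -/

theorem ann₂_vertex (k₀ k : ℝ) (y : Fin N → R.Fock) :
    ann₂ R.annihilate k (opAct (R.vertex k₀) y) =
      numAct (R.R12 k₀ k) (opAct (leg1 (R.vertex k₀)) (ann₂ R.annihilate k y)) := by
  funext ⟨α, j⟩
  simp only [numAct_eq_legAct, opAct_leg1, legAct_sum]
  refine (map_sum (R.annihilate j k) (fun β => R.vertex k₀ α β (y β)) Finset.univ).trans ?_
  exact Finset.sum_congr rfl fun β _ => R.annihilate_vertex k₀ α β k j (y β)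

theorem ann₁_vertex (k₀ k : ℝ) (y : Fin N → R.Fock) :
    ann₁ R.annihilate k (opAct (R.vertex k₀) y) =
      numAct (R.R21 k₀ k) (opAct (leg2 (R.vertex k₀)) (ann₁ R.annihilate k y)) := by
  rw [← swapLegs_ann₂, ann₂_vertex, swapLegs_R12, swapLegs_leg1, swapLegs_ann₂]

theorem vertex_cre₂ (k₀ : ℝ) (Φ : ℝ → Fin N × Fin N → R.Fock) :
    opAct (R.vertex k₀) (cre₂ R.create Φ) =
      cre₂ R.create fun k => numAct (R.R12 k₀ k) (opAct (leg1 (R.vertex k₀)) (Φ k)) := by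
  funext α
  simp only [opAct_apply _ _ α, cre₂, vertex_creation, numAct_eq_legAct, opAct_leg1, legAct_sum]
  rw [← map_sum]
  congr 1
  funext k j
  simp

theorem R12_vertex_vertex_matrix (k₁ k₂ : ℝ) :
    scalarOp R.Fock (R.R12 k₁ k₂) * (leg1 (R.vertex k₁) * leg2 (R.vertex k₂)) =
      leg2 (R.vertex k₂) * (leg1 (R.vertex k₁) * scalarOp R.Fock (R.R12 k₁ k₂)) := by
  apply opAct.injective
  refine LinearMap.ext fun v => funext fun ⟨i, j⟩ => ?_
  simp only [opAct_mul]
  simp only [← show ∀ v, numAct (R.R12 k₁ k₂) v = opAct (scalarOp R.Fock (R.R12 k₁ k₂)) v from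
    fun _ => rfl, numAct_eq_legAct, opAct_leg1, opAct_leg2, legAct_sum, map_sum,
    R12_vertex_vertex, map_legAct]
  simp only [legAct]
  rw [Finset.sum_congr rfl fun _ _ => Finset.sum_comm, Finset.sum_comm]
  conv_rhs => rw [Finset.sum_comm]
  refine Finset.sum_congr rfl fun s _ => ?_
  rw [Finset.sum_congr rfl fun _ _ => Finset.sum_comm, Finset.sum_comm]

theorem leg1_mul (X Y : Matrix (Fin N) (Fin N) (Module.End ℂ V)) :
    leg1 (X * Y) = leg1 X * leg1 Y := by
  apply opAct.injective
  refine LinearMap.ext fun v => funext fun ⟨i, j⟩ => ?_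
  simp only [opAct_mul, opAct_leg1, Matrix.mul_apply, LinearMap.sum_apply, map_sum]
  exact Finset.sum_comm

theorem leg2_mul (X Y : Matrix (Fin N) (Fin N) (Module.End ℂ V)) :
    leg2 (X * Y) = leg2 X * leg2 Y := by
  apply opAct.injective
  refine LinearMap.ext fun v => funext fun ⟨i, j⟩ => ?_
  simp only [opAct_mul, opAct_leg2, Matrix.mul_apply, LinearMap.sum_apply, map_sum]
  exact Finset.sum_comm

theorem leg1_one : leg1 (1 : Matrix (Fin N) (Fin N) (Module.End ℂ V)) = 1 :=
  Matrix.one_kronecker_one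

theorem leg2_one : leg2 (1 : Matrix (Fin N) (Fin N) (Module.End ℂ V)) = 1 :=
  Matrix.one_kronecker_one

theorem scalarOp_mul {ι : Type*} [Fintype ι] [DecidableEq ι] (M M' : Matrix ι ι ℂ) :
    scalarOp V (M * M') = scalarOp V M * scalarOp V M' := Matrix.map_mul

theorem scalarOp_one {ι : Type*} [Fintype ι] [DecidableEq ι] :
    scalarOp V (1 : Matrix ι ι ℂ) = 1 := Matrix.map_one _ (map_zero _) (map_one _)

theorem scalarOp_leg1 (B : Matrix (Fin N) (Fin N) ℂ) :
    scalarOp V (leg1 B) = leg1 (scalarOp V B) := by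
  ext ⟨i, j⟩ ⟨i', j'⟩ : 2
  simp [scalarOp, leg1, Matrix.one_apply, apply_ite]

theorem scalarOp_leg2 (B : Matrix (Fin N) (Fin N) ℂ) :
    scalarOp V (leg2 B) = leg2 (scalarOp V B) := by
  ext ⟨i, j⟩ ⟨i', j'⟩ : 2
  simp [scalarOp, leg2, Matrix.one_apply, apply_ite]

theorem leg1_scalarOp_commute_leg2 (B : Matrix (Fin N) (Fin N) ℂ)
    (X : Matrix (Fin N) (Fin N) (Module.End ℂ V)) :
    Commute (leg1 (scalarOp V B)) (leg2 X) := by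
  apply opAct.injective
  refine LinearMap.ext fun v => funext fun ⟨i, j⟩ => ?_
  simp only [opAct_mul, opAct_leg1, opAct_leg2, scalarOp, Matrix.map_apply,
    Module.algebraMap_end_apply, map_sum, map_smul]
  exact Finset.sum_comm

theorem leg2_scalarOp_commute_leg1 (B : Matrix (Fin N) (Fin N) ℂ)
    (X : Matrix (Fin N) (Fin N) (Module.End ℂ V)) :
    Commute (leg2 (scalarOp V B)) (leg1 X) := by
  apply opAct.injective
  refine LinearMap.ext fun v => funext fun ⟨i, j⟩ => ?_
  simp only [opAct_mul, opAct_leg1, opAct_leg2, scalarOp, Matrix.map_apply,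
    Module.algebraMap_end_apply, map_sum, map_smul]
  exact Finset.sum_comm

theorem R21_vertex_vertex_matrix (k₁ k₂ : ℝ) :
    scalarOp R.Fock (R.R21 k₁ k₂) * (leg2 (R.vertex k₁) * leg1 (R.vertex k₂)) =
      leg1 (R.vertex k₂) * (leg2 (R.vertex k₁) * scalarOp R.Fock (R.R21 k₁ k₂)) := by
  apply opAct.injective
  refine LinearMap.ext fun v => ?_
  have h := congrArg (fun X => swapLegs (opAct X (swapLegs v))) (R.R12_vertex_vertex_matrix k₁ k₂)
  have hR (M : Matrix (Fin N × Fin N) (Fin N × Fin N) ℂ) (v : Fin N × Fin N → R.Fock) :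
      opAct (scalarOp R.Fock M) v = numAct M v := rfl
  simpa only [opAct_mul, hR, swapLegs_R12, swapLegs_leg1, swapLegs_leg2, swapLegs_swapLegs] using h

theorem ann₁_scalarOp (B : Matrix (Fin N) (Fin N) ℂ) (k : ℝ) (y : Fin N → R.Fock) :
    ann₁ R.annihilate k (opAct (scalarOp _ B) y) =
      opAct (leg2 (scalarOp _ B)) (ann₁ R.annihilate k y) := by
  funext ⟨i, j⟩
  rw [opAct_leg2]
  refine (map_sum (R.annihilate i k) (fun s => B j s • y s) Finset.univ).trans ?_
  refine Finset.sum_congr rfl fun s _ => ?_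
  exact map_smul (R.annihilate i k) _ _

theorem scalarOp_cre₂ (B : Matrix (Fin N) (Fin N) ℂ) (Φ : ℝ → Fin N × Fin N → R.Fock) :
    opAct (scalarOp _ B) (cre₂ R.create Φ) =
      cre₂ R.create fun k => opAct (leg1 (scalarOp _ B)) (Φ k) := by
  funext i
  simp only [opAct_apply _ _ i, cre₂, opAct_leg1, scalarOp, Matrix.map_apply,
    Module.algebraMap_end_apply, ← map_smul]
  rw [← map_sum]
  congr 1
  funext k j
  simp

theorem opAct_eq_of_mul_eq_one {ι : Type*} [Fintype ι] [DecidableEq ι]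
    {X Y : Matrix ι ι (Module.End ℂ V)} (h : X * Y = 1) (v : ι → V) : opAct X (opAct Y v) = v := by
  rw [← opAct_mul, h, map_one]
  rfl

theorem ann₁_vertexInv (p k : ℝ) (z : Fin N → R.Fock) :
    ann₁ R.annihilate k (opAct (R.vertexInv p) z) =
      opAct (leg2 (R.vertexInv p)) (numAct (R.R12 k p) (ann₁ R.annihilate k z)) := by
  have h : leg2 (R.vertexInv p) * leg2 (R.vertex p) = 1 := by
    rw [← leg2_mul, vertexInv_mul_vertex, leg2_one]
  conv_rhs => rw [← opAct_eq_of_mul_eq_one (R.vertex_mul_vertexInv p) z, ann₁_vertex,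
    numAct_R12_R21, opAct_eq_of_mul_eq_one h]

theorem vertexInv_cre₂ (p : ℝ) (Φ : ℝ → Fin N × Fin N → R.Fock) :
    opAct (R.vertexInv p) (cre₂ R.create Φ) =
      cre₂ R.create fun k => opAct (leg1 (R.vertexInv p)) (numAct (R.R21 k p) (Φ k)) := by
  have h : leg1 (R.vertex p) * leg1 (R.vertexInv p) = 1 := by
    rw [← leg1_mul, vertex_mul_vertexInv, leg1_one]
  have h' : opAct (R.vertex p) (cre₂ R.create fun k =>
      opAct (leg1 (R.vertexInv p)) (numAct (R.R21 k p) (Φ k))) = cre₂ R.create Φ := by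
    simp only [vertex_cre₂, opAct_eq_of_mul_eq_one h, numAct_R12_R21]
  rw [← h', opAct_eq_of_mul_eq_one (R.vertexInv_mul_vertex p)]

theorem isUnit_vertex (k : ℝ) : IsUnit (R.vertex k) :=
  ⟨⟨R.vertex k, R.vertexInv k, R.vertex_mul_vertexInv k, R.vertexInv_mul_vertex k⟩, rfl⟩

theorem inverse_vertex (k : ℝ) : Ring.inverse (R.vertex k) = R.vertexInv k :=
  Ring.inverse_unit ⟨R.vertex k, R.vertexInv k, R.vertex_mul_vertexInv k,
    R.vertexInv_mul_vertex k⟩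

theorem reflectionOp_vertex (B : ℝ → Matrix (Fin N) (Fin N) ℂ) (k : ℝ) :
    R.reflectionOp R.vertex B k =
      R.vertex k * scalarOp R.Fock (B k) * R.vertexInv (-k) := by
  rw [reflectionOp, inverse_vertex]

/-- The reflection equation is preserved under `B ↦ t B s`, where `t₁, t₂, s₁, s₂` stand for
`T₁(k₁)`, `T₂(k₂)`, `T₁(-k₁)⁻¹`, `T₂(-k₂)⁻¹`, and `r, r₁, r₂, r₃` for `R₁₂(k₁, k₂)`,
`R₂₁(k₂, -k₁)`, `R₁₂(k₁, -k₂)`, `R₂₁(-k₂, -k₁)`. -/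
theorem dressed_reflection {A : Type*} [Ring A] {r r₁ r₂ r₃ t₁ t₂ s₁ s₂ B₁ B₂ : A}
    (hB : r * B₁ * r₁ * B₂ = B₂ * r₂ * B₁ * r₃)
    (h_tt : r * (t₁ * t₂) = t₂ * (t₁ * r))
    (h_st : s₁ * (r₁ * t₂) = t₂ * (r₁ * s₁))
    (h_ts : t₁ * (r₂ * s₂) = s₂ * (r₂ * t₁))
    (h_ss : r₃ * (s₁ * s₂) = s₂ * (s₁ * r₃))
    (h₁ : Commute B₁ t₂) (h₂ : Commute B₁ s₂) (h₃ : Commute B₂ s₁) (h₄ : Commute B₂ t₁) :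
    r * (t₁ * B₁ * s₁) * r₁ * (t₂ * B₂ * s₂) = (t₂ * B₂ * s₂) * r₂ * (t₁ * B₁ * s₁) * r₃ := by
  calc r * (t₁ * B₁ * s₁) * r₁ * (t₂ * B₂ * s₂)
      = r * (t₁ * B₁) * (s₁ * (r₁ * t₂)) * (B₂ * s₂) := by noncomm_ring
    _ = r * t₁ * (B₁ * t₂) * r₁ * (s₁ * B₂) * s₂ := by rw [h_st]; noncomm_ring
    _ = r * (t₁ * t₂) * (B₁ * r₁ * B₂ * s₁ * s₂) := by rw [h₁.eq, ← h₃.eq]; noncomm_ring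
    _ = t₂ * t₁ * (r * B₁ * r₁ * B₂) * s₁ * s₂ := by rw [h_tt]; noncomm_ring
    _ = t₂ * t₁ * B₂ * r₂ * B₁ * (r₃ * (s₁ * s₂)) := by rw [hB]; noncomm_ring
    _ = t₂ * (t₁ * B₂) * r₂ * (B₁ * s₂) * s₁ * r₃ := by rw [h_ss]; noncomm_ring
    _ = t₂ * B₂ * (t₁ * (r₂ * s₂)) * B₁ * s₁ * r₃ := by rw [← h₄.eq, h₂.eq]; noncomm_ring
    _ = (t₂ * B₂ * s₂) * r₂ * (t₁ * B₁ * s₁) * r₃ := by rw [h_ts]; noncomm_ring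

/-- The exchange relation of `t` with `t'` gives that of `t⁻¹` with `t'`. -/
theorem intertwine_inverse {A : Type*} [Ring A] {r t s t' : A} (h : r * (t' * t) = t * (t' * r))
    (hts : t * s = 1) (hst : s * t = 1) : s * (r * t') = t' * (r * s) := by
  calc s * (r * t') = s * (r * (t' * t)) * s := by
        simp only [mul_assoc, hts, mul_one]
    _ = t' * (r * s) := by
        rw [h, ← mul_assoc s, hst, one_mul, mul_assoc]

/-- The exchange relation of `t` with `t'` gives that of `t⁻¹` with `t'⁻¹`. -/
theorem intertwine_inverse_inverse {A : Type*} [Ring A] {r t s t' s' : A}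
    (h : r * (t' * t) = t * (t' * r)) (hts : t * s = 1) (hst : s * t = 1) (hts' : t' * s' = 1)
    (hst' : s' * t' = 1) : r * (s * s') = s' * (s * r) := by
  calc r * (s * s') = s' * (s * t) * t' * r * s * s' := by
        rw [hst, mul_one, hst', one_mul, mul_assoc]
    _ = s' * s * (t * (t' * r)) * s * s' := by simp only [mul_assoc]
    _ = s' * s * r * (t' * (t * s) * s') := by rw [← h]; simp only [mul_assoc]
    _ = s' * (s * r) := by rw [hts, mul_one, hts', mul_one, mul_assoc]

/-- The operator `b(k) = T(k) B(k) T(-k)⁻¹` inherits the relations of a reflection operator. -/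
theorem isReflectionOp_reflectionOp {B : ℝ → Matrix (Fin N) (Fin N) ℂ}
    (hB : ∀ k₁ k₂ : ℝ, R.R12 k₁ k₂ * leg1 (B k₁) * R.R21 k₂ (-k₁) * leg2 (B k₂) =
      leg2 (B k₂) * R.R12 k₁ (-k₂) * leg1 (B k₁) * R.R21 (-k₂) (-k₁))
    (hB_inv : ∀ k : ℝ, B k * B (-k) = 1) : R.IsReflectionOp (R.reflectionOp R.vertex B) where
  ann₁_b k₁ k₂ y := by
    simp only [reflectionOp_vertex, leg2_mul, opAct_mul, ann₁_vertex, ann₁_scalarOp,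
      ann₁_vertexInv]
  b_cre₂ k₁ Φ := by
    simp only [reflectionOp_vertex, leg1_mul, opAct_mul, vertex_cre₂, scalarOp_cre₂,
      vertexInv_cre₂]
  b_b k₁ k₂ := by
    have hTS₁ (k : ℝ) : leg1 (R.vertex k) * leg1 (R.vertexInv k) = 1 := by
      rw [← leg1_mul, vertex_mul_vertexInv, leg1_one]
    have hST₁ (k : ℝ) : leg1 (R.vertexInv k) * leg1 (R.vertex k) = 1 := by
      rw [← leg1_mul, vertexInv_mul_vertex, leg1_one]
    have hTS₂ (k : ℝ) : leg2 (R.vertex k) * leg2 (R.vertexInv k) = 1 := by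
      rw [← leg2_mul, vertex_mul_vertexInv, leg2_one]
    have hST₂ (k : ℝ) : leg2 (R.vertexInv k) * leg2 (R.vertex k) = 1 := by
      rw [← leg2_mul, vertexInv_mul_vertex, leg2_one]
    simp only [reflectionOp_vertex, leg1_mul, leg2_mul]
    refine dressed_reflection ?_ (R.R12_vertex_vertex_matrix k₁ k₂) ?_ ?_ ?_
      (leg1_scalarOp_commute_leg2 _ _) (leg1_scalarOp_commute_leg2 _ _)
      (leg2_scalarOp_commute_leg1 _ _) (leg2_scalarOp_commute_leg1 _ _)
    · simpa only [scalarOp_mul, scalarOp_leg1, scalarOp_leg2] using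
        congrArg (scalarOp R.Fock) (hB k₁ k₂)
    · exact intertwine_inverse (R.R21_vertex_vertex_matrix k₂ (-k₁)) (hTS₁ _) (hST₁ _)
    · exact (intertwine_inverse (R.R12_vertex_vertex_matrix k₁ (-k₂)) (hTS₂ _) (hST₂ _)).symm
    · exact intertwine_inverse_inverse (R.R21_vertex_vertex_matrix (-k₂) (-k₁)) (hTS₁ _) (hST₁ _)
        (hTS₂ _) (hST₂ _)
  b_inv k := by
    simp only [reflectionOp_vertex, neg_neg]
    calc _ = R.vertex k * scalarOp R.Fock (B k) * (R.vertexInv (-k) * R.vertex (-k)) *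
          scalarOp R.Fock (B (-k)) * R.vertexInv k := by noncomm_ring
      _ = R.vertex k * (scalarOp R.Fock (B k) * scalarOp R.Fock (B (-k))) * R.vertexInv k := by
        rw [vertexInv_mul_vertex]; noncomm_ring
      _ = 1 := by
        rw [← scalarOp_mul, hB_inv, scalarOp_one, mul_one, vertex_mul_vertexInv]

/-! ### Existence and uniqueness of the well-bred vertex operator -/

theorem isWellBred_vertex : R.IsWellBred R.vertex where
  L_a k₁ k₂ i i' j := by
    refine LinearMap.ext fun φ => ?_
    have h := R.legAct_R12_R21 k₂ k₁
      (fun j s => R.vertex k₁ s i' (R.annihilate j k₂ φ)) j i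
    simp only [legAct_R21, ← annihilate_vertex] at h
    rw [← legAct_R21 R k₂ k₁ (fun s j => R.annihilate j k₂ (R.vertex k₁ s i' φ))] at h
    simp only [LinearMap.sum_apply]
    exact h.symm
  L_adag k₁ i i' j Φ := by
    have h := R.vertex_creation k₁ i i' fun k => Pi.single j (Φ k)
    rw [creation_single, creation_apply] at h
    rw [h, Finset.sum_comm]
    refine Finset.sum_congr rfl fun j' _ => ?_
    rw [← map_sum]
    congr 1
    funext k
    rw [legAct, Finset.sum_apply]
    refine Finset.sum_congr rfl fun s _ => ?_
    rw [Finset.sum_eq_single j (fun b _ hb => by simp [hb]) (by simp)]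
    simp

variable {R} in
/-- The exchange relation of a well-bred operator with the annihilators, solved by unitarity for the
product with the annihilator on the left. -/
theorem IsWellBred.annihilate_apply {T : ℝ → Matrix (Fin N) (Fin N) (Module.End ℂ R.Fock)}
    (hT : R.IsWellBred T) (k₀ : ℝ) (α β : Fin N) (k : ℝ) (j : Fin N) (φ : R.Fock) :
    R.annihilate j k (T k₀ α β φ) =
      legAct (R.R12 k₀ k) (fun s j' => T k₀ s β (R.annihilate j' k φ)) α j := by
  have h (s j' : Fin N) : T k₀ s β (R.annihilate j' k φ) =
      legAct (R.R21 k k₀) (fun t j'' => R.annihilate j'' k (T k₀ t β φ)) s j' := by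
    have := congrArg (fun X => X φ) (hT.L_a k₀ k s β j')
    simp only [LinearMap.sum_apply] at this
    exact this
  simp only [h]
  exact (R.legAct_R12_R21 k₀ k (fun t j'' => R.annihilate j'' k (T k₀ t β φ)) α j).symm

theorem eq_vertex_of_isWellBred {T : ℝ → Matrix (Fin N) (Fin N) (Module.End ℂ R.Fock)}
    (hT : R.IsVertexOperator T) (hT' : R.IsWellBred T) : T = R.vertex :=
  funext fun _ => R.eq_vertex (hT.component_nil R _) (hT'.annihilate_apply _)

end RMatrix
end

theorem mainTheorem1 (N : ℕ) (R : RMatrix N) :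
    R.ZFRelations R.annihilate R.create ∧
    (∃! T : ℝ → Matrix (Fin N) (Fin N) (Module.End ℂ R.Fock),
      R.IsVertexOperator T ∧ R.IsWellBred T) ∧
    ∀ T : ℝ → Matrix (Fin N) (Fin N) (Module.End ℂ R.Fock),
      R.IsVertexOperator T → R.IsWellBred T →
      (∀ k : ℝ, IsUnit (T k)) ∧
      ∀ B : ℝ → Matrix (Fin N) (Fin N) ℂ,
        (∀ k₁ k₂ : ℝ,
          R.R12 k₁ k₂ * leg1 (B k₁) * R.R21 k₂ (-k₁) * leg2 (B k₂) =
            leg2 (B k₂) * R.R12 k₁ (-k₂) * leg1 (B k₁) * R.R21 (-k₂) (-k₁)) →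
        (∀ k : ℝ, B k * B (-k) = 1) →
        R.BoundaryRelations (R.boundaryA (R.reflectionOp T B))
          (R.boundaryAdag (R.reflectionOp T B)) (R.reflectionOp T B) ∧
        RMatrix.ReflectionInvariant (R.boundaryA (R.reflectionOp T B))
          (R.boundaryAdag (R.reflectionOp T B)) (R.reflectionOp T B) := by
  refine ⟨R.zfRelations_fock, ⟨R.vertex, ⟨R.isVertexOperator_vertex, R.isWellBred_vertex⟩,
    fun T hT => R.eq_vertex_of_isWellBred hT.1 hT.2⟩, fun T hT hT' => ?_⟩
  obtain rfl := R.eq_vertex_of_isWellBred hT hT'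
  refine ⟨R.isUnit_vertex, fun B hB hB_inv => ?_⟩
  have hb := R.isReflectionOp_reflectionOp hB hB_inv
  exact ⟨hb.boundaryRelations, hb.reflectionInvariant⟩
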